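/- Let $P>0$ and $\epsilon>0$. There is $\delta_0\in(0,P]$, depending only on $P$ and $\epsilon$, such that the following holds for every $\delta\in(0,\delta_0)$; put $P'=P-\delta$. For each $n$ let $\ell_n\in\mathbb{N}$ be a number of users and $\alpha_n\in[0,1]$ an activity probability, and put $k_n=\alpha_n\ell_n$. Assume that $k_n\to\infty$, that $k_n=O(n)$, and that $\ell_n e^{-ck_n}\to 0$ for every constant $c>0$. With $H_2(p)=-p\log p-(1-p)\log(1-p)$ (natural logarithms) let $$\theta_n=\frac{2\ell_nH_2(\alpha_n)}{n\log(1+k_nP)},$$ and assume that either $\theta_n\to 0$ or $\liminf_{n\to\infty}\theta_n>0$. Let $n_0=n_0(n)$ be an integer at distance less than $1$ from $$\begin{cases}\epsilon n & \text{if }\theta_n\to0,\\ \left(1+\dfrac{\epsilon}{\log(1+k_nP)}\right)\theta_n n & \text{otherwise.}\end{cases}$$ Let $(\delta_n)$ be a decreasing sequence of positive numbers with $\delta_n^2k_n\to\infty$ and $\delta_n\log k_n\to0$. Let $\mathbf{S}$ be a random $n_0\times\ell_n$ matrix, whose columns are the signatures of the users, with i.i.d. $\mathcal N(0,P')$ entries;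 let $\mathbf X\in\{0,1\}^{\ell_n}$ have i.i.d. Bernoulli entries with mean $\alpha_n$ (the indicator of the set of active users); let $\mathbf Z\in\mathbb R^{n_0}$ have i.i.d. $\mathcal N(0,1)$ entries; and let $\mathbf S,\mathbf X,\mathbf Z$ be independent. From $\mathbf S$ and $\mathbf Y=\mathbf S\mathbf X+\mathbf Z$ the receiver computes $\hat{\mathbf X}$, a minimizer (with ties broken in any way) of $\|\mathbf Y-\mathbf S\mathbf x\|_2^2$ over all $\mathbf x\in\{0,1\}^{\ell_n}$ with $\|\mathbf x\|_0\le(1+2\delta_n)k_n$. Then $$\mathbb P\{\hat{\mathbf X}\ne\mathbf X\}\to0\qquad\text{as }n\to\infty .$$ -/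

import Mathlib

open MeasureTheory ProbabilityTheory Filter Topology Asymptotics

noncomputable section

namespace ManyAccess

/-- Average number of active users, `k = α ℓ`. -/
def avgActive (ℓ : ℕ → ℕ) (α : ℕ → unitInterval) (n : ℕ) : ℝ := (α n : ℝ) * (ℓ n : ℝ)

/-- `θ_n = 2 ℓ_n H₂(α_n) / (n log (1 + k_n P))`, with natural logarithms. -/
def theta (P : ℝ) (ℓ : ℕ → ℕ) (α : ℕ → unitInterval) (n : ℕ) : ℝ :=
  2 * (ℓ n : ℝ) * Real.binEntropy (α n) / ((n : ℝ) * Real.log (1 + avgActive ℓ α n * P))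

open Classical in
/-- The (real-valued) signature length `n₀`: it is `ε n` if `θ_n → 0`, and
`(1 + ε / log (1 + k_n P)) θ_n n` otherwise. -/
def signatureLength (P ε : ℝ) (ℓ : ℕ → ℕ) (α : ℕ → unitInterval) (n : ℕ) : ℝ :=
  if Tendsto (theta P ℓ α) atTop (𝓝 0) then ε * (n : ℝ)
  else (1 + ε / Real.log (1 + avgActive ℓ α n * P)) * theta P ℓ α n * (n : ℝ)

/-- A binary activity vector `x ∈ {0,1}^ℓ`, read as a real vector. -/
def toVec {ℓ : ℕ} (x : Fin ℓ → Bool) : Fin ℓ → ℝ := fun j => if x j then 1 else 0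

/-- Support size `‖x‖₀` of a binary vector. -/
def supportSize {ℓ : ℕ} (x : Fin ℓ → Bool) : ℕ := (Finset.univ.filter fun j => x j = true).card

/-- The matrix-vector product `S x`; column `j` of `S` is the signature of user `j`. -/
def superpose {N ℓ : ℕ} (S : Fin N → Fin ℓ → ℝ) (x : Fin ℓ → Bool) : Fin N → ℝ :=
  fun i => ∑ j, S i j * toVec x j

/-- Received vector `Y = S X + Z`. -/
def received {N ℓ : ℕ} (S : Fin N → Fin ℓ → ℝ) (x : Fin ℓ → Bool) (z : Fin N → ℝ) :
    Fin N → ℝ := superpose S x + z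

/-- Squared Euclidean residual `‖y - S x‖₂²`. -/
def residual {N ℓ : ℕ} (S : Fin N → Fin ℓ → ℝ) (y : Fin N → ℝ) (x : Fin ℓ → Bool) : ℝ :=
  ∑ i, (y i - superpose S x i) ^ 2

/-- `x` solves: minimize `‖y - S x‖₂²` over binary vectors `x` with `‖x‖₀ ≤ r`. -/
def IsLeastSquares {N ℓ : ℕ} (r : ℝ) (S : Fin N → Fin ℓ → ℝ) (y : Fin N → ℝ)
    (x : Fin ℓ → Bool) : Prop :=
  (supportSize x : ℝ) ≤ r ∧
    ∀ x' : Fin ℓ → Bool, (supportSize x' : ℝ) ≤ r → residual S y x ≤ residual S y x'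

/-- An activity decoder knows the signatures `S` and the received vector `y`. -/
abbrev Decoder (N ℓ : ℕ) := (Fin N → Fin ℓ → ℝ) → (Fin N → ℝ) → Fin ℓ → Bool

/-- Law of the signatures: all entries i.i.d. centred Gaussian with variance `v`. -/
def signatureLaw (N ℓ : ℕ) (v : ℝ) : Measure (Fin N → Fin ℓ → ℝ) :=
  Measure.pi fun _ : Fin N => Measure.pi fun _ : Fin ℓ => gaussianReal 0 v.toNNReal

/-- Law of the activities: i.i.d. Bernoulli with mean `a`. -/
def activityLaw (ℓ : ℕ) (a : unitInterval) : Measure (Fin ℓ → Bool) :=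
  Measure.pi fun _ : Fin ℓ => bernoulliMeasure true false a

/-- Law of the noise: i.i.d. standard Gaussian. -/
def noiseLaw (N : ℕ) : Measure (Fin N → ℝ) :=
  Measure.pi fun _ : Fin N => gaussianReal 0 1

/-- Probability that `D (S, S X + Z) ≠ X`, where the signatures `S`, the activities `X` and the
noise `Z` are independent. -/
def errorProb {N ℓ : ℕ} (v : ℝ) (a : unitInterval) (D : Decoder N ℓ) : ENNReal :=
  ((signatureLaw N ℓ v).prod ((activityLaw ℓ a).prod (noiseLaw N)))
    {ω | D ω.1 (received ω.1 ω.2.1 ω.2.2) ≠ ω.2.1}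

end ManyAccess

end

/-! Decoding fails only if the support `T` of `X` has atypical size or if some admissible `U ≠ T`
fits `Y` at least as well as `T`. Sizes are handled by concentration (`activity_concentration`,
tending to zero because `d^2 k → ∞`). The rest is a union bound over `U`, for a fixed `T` of typical
size. Write `L = log (1 + kP)`, which tends to infinity. The choice of signature length enters only
through the margin `ℓ H₂(α) + c N ≤ (N/2) L` and through `k = O(N)`.

A crude Chernoff bound (`pairwise_error`) gives a pair at Hamming distance `w` the exponent `(N/2)
log (1 + wv/4)`, where `v` is the signature variance. At distance proportional to `k` it loses
`O(N)` against `(N/2) L`, which is harmless whenever the number of competitors is small enough. At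
distance `w ≤ ζ k` there are at most `exp (w log (1/α) + 4 √(wk))` of them, and concavity of the
logarithm compares the exponent with this (`measure_near_le`). At larger distance, if `U` still
catches a fraction `η` of `T`, the number of candidates for `U \ T` loses about `(η/2) k log (1/α)`
in its exponent, so an unbounded multiple of `N` is left to absorb the loss (`measure_far_le`).

If `U` misses nearly all of `T`, nothing is saved in the counting and the constant in the exponent
matters. Restricting to typical norms of `Z` and of `Z + ∑_{T \ U}` yields the sharp exponent `(N/2)
log (1 + |T \ U| v)` up to a small multiple of `N` (`typical_pairwise_error`). The margin `c N` then
pays for this error, for the power back-off `δ`, for the admissible excess in size, and for the few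
choices of `T \ U` (`measure_missing_le`). -/

namespace ManyAccess

/-! ### Gaussian integrals of exponentials of squares -/

section GaussianExponentials

open Real

/-- Exponential moment of a shifted square of a centred Gaussian variable. -/
lemma lintegral_exp_neg_mul_sq_gaussianReal (v : NNReal) (a y : ℝ) (h : 0 < 1 + 2 * a * v) :
    ∫⁻ g, ENNReal.ofReal (exp (-(a * (y + g) ^ 2))) ∂(gaussianReal 0 v) =
      ENNReal.ofReal (exp (-(log (1 + 2 * a * v) / 2) - a * y ^ 2 / (1 + 2 * a * v))) := by
  rcases eq_or_ne v 0 with rfl | hv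
  · simp [gaussianReal_zero_var, lintegral_dirac]
  have hv0 : (0 : ℝ) < v := by positivity
  set q : ℝ := 1 + 2 * a * v with hq
  -- Completing the square: the tilted density is a constant times a Gaussian density with variance
  -- `v / q` and mean `-2ayv/q`.
  let v' : NNReal := v / q.toNNReal
  have hv'c : (v' : ℝ) = v / q := by simp [v', h.le]
  have hv' : v' ≠ 0 := by
    have : (0 : ℝ) < v' := by rw [hv'c]; positivity
    exact_mod_cast this.ne'
  rw [gaussianReal_of_var_ne_zero _ hv,
    lintegral_withDensity_eq_lintegral_mul _ (measurable_gaussianPDF 0 v) (by fun_prop)]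
  have key : ∀ g : ℝ, (gaussianPDF 0 v * fun g => ENNReal.ofReal (exp (-(a * (y + g) ^ 2)))) g =
      ENNReal.ofReal (exp (-(log q / 2) - a * y ^ 2 / q)) *
        gaussianPDF (-(2 * a * y * v / q)) v' g := by
    intro g
    rw [Pi.mul_apply, gaussianPDF, gaussianPDF, ← ENNReal.ofReal_mul (gaussianPDFReal_nonneg _ _ _),
      ← ENNReal.ofReal_mul (exp_pos _).le]
    congr 1
    rw [gaussianPDFReal, gaussianPDFReal, hv'c]
    have h1 : √(2 * π * (v / q)) = √(2 * π * v) * exp (-(log q / 2)) := by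
      rw [← mul_div_assoc, sqrt_div (by positivity), exp_neg, ← log_sqrt h.le,
        exp_log (sqrt_pos.2 h), div_eq_mul_inv]
    have h2 : -(g - 0) ^ 2 / (2 * (v : ℝ)) + -(a * (y + g) ^ 2) =
        -(a * y ^ 2 / q) + -(g - -(2 * a * y * v / q)) ^ 2 / (2 * (v / q)) := by
      field_simp
      rw [hq]
      ring
    have h4 : exp (-(log q / 2) - a * y ^ 2 / q) =
        exp (-(log q / 2)) * exp (-(a * y ^ 2 / q)) := by rw [← exp_add, ← sub_eq_add_neg]
    rw [h1, h4, mul_inv, ← exp_neg, mul_assoc, ← exp_add, h2, exp_add]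
    have h3 : exp (-(log q / 2)) * exp (-(-(log q / 2))) = 1 := by rw [← exp_add]; simp
    linear_combination (-(√(2 * π * v))⁻¹ * exp (-(a * y ^ 2 / q)) *
      exp (-(g - -(2 * a * y * v / q)) ^ 2 / (2 * (v / q)))) * h3
  simp_rw [key]
  rw [lintegral_const_mul _ (measurable_gaussianPDF _ _), lintegral_gaussianPDF_eq_one _ hv',
    mul_one]

end GaussianExponentials

/-! ### Sums of Gaussian entries over disjoint sets of users -/

section RowSums

variable {ℓ : ℕ}

lemma iIndepFun_coord (v : NNReal) :
    iIndepFun (fun (j : Fin ℓ) (s : Fin ℓ → ℝ) => s j)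
      (Measure.pi fun _ : Fin ℓ => gaussianReal 0 v) :=
  iIndepFun_pi (X := fun _ => id) fun _ => aemeasurable_id

lemma indepFun_sum_sum {A B : Finset (Fin ℓ)} (hAB : Disjoint A B) (v : NNReal) :
    IndepFun (fun s : Fin ℓ → ℝ => ∑ j ∈ A, s j) (fun s : Fin ℓ → ℝ => ∑ j ∈ B, s j)
      (Measure.pi fun _ : Fin ℓ => gaussianReal 0 v) := by
  have h := (iIndepFun_coord (ℓ := ℓ) v).indepFun_finset A B hAB (fun i => measurable_pi_apply i)
  have h2 := h.comp (φ := fun x : A → ℝ => ∑ j, x j) (ψ := fun x : B → ℝ => ∑ j, x j)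
    (by fun_prop) (by fun_prop)
  convert h2 using 1 <;>
  · funext s
    exact (Finset.sum_coe_sort _ fun j => s j).symm

lemma map_sum_gaussian (A : Finset (Fin ℓ)) (v : NNReal) :
    (Measure.pi fun _ : Fin ℓ => gaussianReal 0 v).map (fun s => ∑ j ∈ A, s j) =
      gaussianReal 0 (A.card * v) := by
  induction A using Finset.induction_on with
  | empty => simp [gaussianReal_zero_var, Measure.map_const]
  | insert a A ha ih =>
    have h1 : (Measure.pi fun _ : Fin ℓ => gaussianReal 0 v).map
        (fun s => ∑ j ∈ ({a} : Finset (Fin ℓ)), s j) = gaussianReal 0 v := by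
      simp_rw [Finset.sum_singleton]
      exact (measurePreserving_eval (fun _ : Fin ℓ => gaussianReal 0 v) a).map_eq
    have := gaussianReal_add_gaussianReal_of_indepFun
      (indepFun_sum_sum (Finset.disjoint_singleton_left.2 ha) v) h1 ih
    rw [zero_add] at this
    rw [Finset.card_insert_of_notMem ha]
    convert this using 2
    · funext s; simp [Finset.sum_insert ha]
    · push_cast; ring

/-- Sums over disjoint index sets of i.i.d. Gaussian variables are independent Gaussian. -/
lemma lintegral_sum_sum {A B : Finset (Fin ℓ)} (hAB : Disjoint A B) (v : NNReal)
    {F : ℝ → ℝ → ENNReal} (hF : Measurable (Function.uncurry F)) :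
    ∫⁻ s, F (∑ j ∈ A, s j) (∑ j ∈ B, s j) ∂(Measure.pi fun _ : Fin ℓ => gaussianReal 0 v) =
      ∫⁻ x, ∫⁻ y, F x y ∂(gaussianReal 0 (B.card * v)) ∂(gaussianReal 0 (A.card * v)) := by
  have h := (indepFun_iff_map_prod_eq_prod_map_map (by fun_prop) (by fun_prop)).1
    (indepFun_sum_sum hAB v)
  rw [map_sum_gaussian, map_sum_gaussian] at h
  have h2 := lintegral_prod (μ := gaussianReal 0 (A.card * v)) (ν := gaussianReal 0 (B.card * v))
    (Function.uncurry F) hF.aemeasurable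
  rw [← h, lintegral_map hF (by fun_prop)] at h2
  exact h2

end RowSums

/-! ### Exponential Markov inequality for product measures -/

section Chernoff

/-- Markov's inequality for the exponential of a sum over independent pairs. -/
lemma chernoff_pi_prod {X Y : Type*} [MeasurableSpace X] [MeasurableSpace Y] {N : ℕ}
    (ν : Measure X) (ρ : Measure Y) [IsProbabilityMeasure ν] [IsProbabilityMeasure ρ]
    {f : X → Y → ℝ} (hf : Measurable (Function.uncurry f)) (C : ℝ) :
    ((Measure.pi fun _ : Fin N => ν).prod (Measure.pi fun _ : Fin N => ρ))
        {ω | 0 ≤ C + ∑ i, f (ω.1 i) (ω.2 i)} ≤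
      ENNReal.ofReal (Real.exp C) *
        (∫⁻ s, ∫⁻ z, ENNReal.ofReal (Real.exp (f s z)) ∂ρ ∂ν) ^ N := by
  have hfi : Measurable fun p : X × Y => ENNReal.ofReal (Real.exp (f p.1 p.2)) := by
    have : Measurable fun p : X × Y => f p.1 p.2 := hf
    fun_prop
  have hm : Measurable fun ω : (Fin N → X) × (Fin N → Y) =>
      ∏ i, ENNReal.ofReal (Real.exp (f (ω.1 i) (ω.2 i))) := by
    refine Finset.measurable_prod _ fun i _ => ?_
    exact hfi.comp (by fun_prop : Measurable
      fun ω : (Fin N → X) × (Fin N → Y) => (ω.1 i, ω.2 i))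
  have hexp : ∀ ω : (Fin N → X) × (Fin N → Y),
      ENNReal.ofReal (Real.exp (C + ∑ i, f (ω.1 i) (ω.2 i))) =
        ENNReal.ofReal (Real.exp C) * ∏ i, ENNReal.ofReal (Real.exp (f (ω.1 i) (ω.2 i))) := by
    intro ω
    rw [Real.exp_add, Real.exp_sum, ENNReal.ofReal_mul (Real.exp_pos _).le,
      ENNReal.ofReal_prod_of_nonneg fun i _ => (Real.exp_pos _).le]
  have hint : ∫⁻ ω, ∏ i, ENNReal.ofReal (Real.exp (f (ω.1 i) (ω.2 i)))
      ∂((Measure.pi fun _ : Fin N => ν).prod (Measure.pi fun _ : Fin N => ρ)) =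
        (∫⁻ s, ∫⁻ z, ENNReal.ofReal (Real.exp (f s z)) ∂ρ ∂ν) ^ N := by
    rw [lintegral_prod _ hm.aemeasurable]
    have hin : ∀ s : Fin N → X, ∫⁻ z, ∏ i, ENNReal.ofReal (Real.exp (f (s i) (z i)))
        ∂(Measure.pi fun _ : Fin N => ρ) =
          ∏ i, ∫⁻ z, ENNReal.ofReal (Real.exp (f (s i) z)) ∂ρ := by
      intro s
      have hs : ∀ i, Measurable fun z : Y => ENNReal.ofReal (Real.exp (f (s i) z)) := fun i =>
        hfi.comp (measurable_const.prodMk measurable_id)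
      rw [lintegral_prod_eq_prod_lintegral_of_indepFun Finset.univ
        (fun i (z : Fin N → Y) => ENNReal.ofReal (Real.exp (f (s i) (z i))))
        (iIndepFun_pi fun i => (hs i).aemeasurable)
        (fun i => (hs i).comp (measurable_pi_apply i))]
      refine Finset.prod_congr rfl fun i _ => ?_
      exact (measurePreserving_eval (fun _ : Fin N => ρ) i).lintegral_comp (hs i)
    simp_rw [hin]
    have hg : Measurable fun s : X => ∫⁻ z, ENNReal.ofReal (Real.exp (f s z)) ∂ρ :=
      hfi.lintegral_prod_right'
    rw [lintegral_prod_eq_prod_lintegral_of_indepFun Finset.univ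
        (fun i (s : Fin N → X) => ∫⁻ z, ENNReal.ofReal (Real.exp (f (s i) z)) ∂ρ)
        (iIndepFun_pi fun i => hg.aemeasurable)
        (fun i => hg.comp (measurable_pi_apply i))]
    rw [Finset.prod_congr rfl fun i _ =>
      (measurePreserving_eval (fun _ : Fin N => ν) i).lintegral_comp hg]
    simp
  calc _ ≤ ((Measure.pi fun _ : Fin N => ν).prod (Measure.pi fun _ : Fin N => ρ))
        {ω | 1 ≤ ENNReal.ofReal (Real.exp (C + ∑ i, f (ω.1 i) (ω.2 i)))} := by
        refine measure_mono fun ω hω => ?_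
        simpa [ENNReal.one_le_ofReal] using hω
    _ ≤ (∫⁻ ω, ENNReal.ofReal (Real.exp (C + ∑ i, f (ω.1 i) (ω.2 i)))
        ∂((Measure.pi fun _ : Fin N => ν).prod (Measure.pi fun _ : Fin N => ρ))) / 1 := by
        refine meas_ge_le_lintegral_div ?_ one_ne_zero ENNReal.one_ne_top
        simp_rw [hexp]
        exact (hm.const_mul _).aemeasurable
    _ = _ := by
        simp_rw [hexp]
        rw [div_one, lintegral_const_mul _ hm, hint]

end Chernoff

/-! ### Tail and pairwise error probabilities -/

section GaussianEvents

open Real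

variable {N ℓ : ℕ}

/-- The result again has the form `exp (c' - a' y ^ 2)`, so independent Gaussian variables can be
integrated out one after the other, each time only updating the two coefficients. -/
lemma lintegral_exp_sub_mul_sq_gaussianReal (v : NNReal) (c a y : ℝ) (h : 0 < 1 + 2 * a * v) :
    ∫⁻ g, ENNReal.ofReal (exp (c - a * (y + g) ^ 2)) ∂(gaussianReal 0 v) =
      ENNReal.ofReal (exp (c - log (1 + 2 * a * v) / 2 - a * y ^ 2 / (1 + 2 * a * v))) := by
  have h1 : ∀ g : ℝ, ENNReal.ofReal (exp (c - a * (y + g) ^ 2)) =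
      ENNReal.ofReal (exp c) * ENNReal.ofReal (exp (-(a * (y + g) ^ 2))) := fun g => by
    rw [← ENNReal.ofReal_mul (exp_pos _).le, ← exp_add, ← sub_eq_add_neg]
  simp_rw [h1]
  rw [lintegral_const_mul _ (by fun_prop), lintegral_exp_neg_mul_sq_gaussianReal v a y h,
    ← ENNReal.ofReal_mul (exp_pos _).le, ← exp_add]
  congr 2
  ring

lemma ofReal_exp_mul_pow (C E : ℝ) (N : ℕ) :
    ENNReal.ofReal (exp C) * ENNReal.ofReal (exp E) ^ N = ENNReal.ofReal (exp (C + N * E)) := by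
  rw [← ENNReal.ofReal_pow (exp_pos _).le, ← ENNReal.ofReal_mul (exp_pos _).le, ← exp_nat_mul,
    ← exp_add]

instance (N ℓ : ℕ) (v : ℝ) : IsProbabilityMeasure (signatureLaw N ℓ v) := by
  unfold signatureLaw; infer_instance

instance (N : ℕ) : IsProbabilityMeasure (noiseLaw N) := by
  unfold noiseLaw; infer_instance

/-- The rows of `(S, Z)` are i.i.d., so the exponential moment is an `N`-th power. The noise is put
on the outside of the integral because the signature sums are integrated out first, for fixed `z`.
-/
lemma chernoff_signature_noise (v : ℝ) {f : (Fin ℓ → ℝ) → ℝ → ℝ}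
    (hf : Measurable (Function.uncurry f)) (C E : ℝ)
    (hE : ∫⁻ z, ∫⁻ s, ENNReal.ofReal (exp (f s z))
      ∂(Measure.pi fun _ : Fin ℓ => gaussianReal 0 v.toNNReal) ∂(gaussianReal 0 1) =
        ENNReal.ofReal (exp E)) :
    ((signatureLaw N ℓ v).prod (noiseLaw N)) {ω | 0 ≤ C + ∑ i, f (ω.1 i) (ω.2 i)} ≤
      ENNReal.ofReal (exp (C + N * E)) := by
  refine (chernoff_pi_prod _ _ hf C).trans_eq ?_
  rw [lintegral_lintegral_swap, hE, ofReal_exp_mul_pow]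
  exact ((measurable_exp.comp hf).ennreal_ofReal).aemeasurable

/-- Upper tail of the squared norm of the noise. -/
lemma noise_norm_tail (v : ℝ) {t : ℝ} (ht0 : 0 < t) (ht1 : t ≤ 1) :
    ((signatureLaw N ℓ v).prod (noiseLaw N)) {ω | (1 + t) * N < ∑ i, ω.2 i ^ 2} ≤
      ENNReal.ofReal (exp (-(N * (t ^ 2 / 16)))) := by
  -- The tilt `t/8` costs at most `t/8 + t²/16` per coordinate and gains `t(1+t)/8`. The zeros only
  -- match the shape of the Gaussian integral, used with the negative coefficient `-(t/8)`.
  have h := chernoff_signature_noise (N := N) (ℓ := ℓ) v (f := fun _ z => 0 - -(t / 8) * (0 + z) ^ 2)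
    (by unfold Function.uncurry; fun_prop) (-(t / 8 * ((1 + t) * N)))
    (0 - log (1 + 2 * -(t / 8) * (1 : NNReal)) / 2 -
      -(t / 8) * 0 ^ 2 / (1 + 2 * -(t / 8) * (1 : NNReal))) (by
      simp only [lintegral_const, measure_univ, mul_one]
      exact lintegral_exp_sub_mul_sq_gaussianReal 1 0 (-(t / 8)) 0 (by norm_num; linarith))
  refine (measure_mono fun ω hω => ?_).trans (h.trans (ENNReal.ofReal_le_ofReal (exp_le_exp.2 ?_)))
  · simp only [Set.mem_ofPred_eq] at hω ⊢
    rw [Finset.sum_congr rfl fun i _ =>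
      (by ring : (0 - -(t / 8) * (0 + ω.2 i) ^ 2) = t / 8 * ω.2 i ^ 2), ← Finset.mul_sum]
    nlinarith
  · have hlog : -(t / 4) - 2 * (t / 4) ^ 2 ≤ log (1 - t / 4) := by
      have h0 : (0 : ℝ) < 1 - t / 4 := by linarith
      refine le_trans ?_ (one_sub_inv_le_log_of_pos h0)
      have hi : (1 - t / 4)⁻¹ ≤ 1 + t / 4 + 2 * (t / 4) ^ 2 := by
        rw [inv_le_iff_one_le_mul₀ h0]
        nlinarith [mul_nonneg (sq_nonneg (t / 4)) (by linarith : (0 : ℝ) ≤ 1 - 2 * (t / 4))]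
      linarith
    have hN : (0 : ℝ) ≤ N := N.cast_nonneg
    have e : (1 + 2 * -(t / 8) * ((1 : NNReal) : ℝ)) = 1 - t / 4 := by norm_num; ring
    rw [e]
    have : -(t / 8 * (1 + t)) + (0 - log (1 - t / 4) / 2) ≤ - (t ^ 2 / 16) := by nlinarith
    have := mul_le_mul_of_nonneg_left this hN
    simp only [zero_pow two_ne_zero, mul_zero, zero_div, sub_zero]
    linarith

/-- Lower tail of the squared norm of the noise plus a sum of signatures. -/
lemma signal_norm_tail {v : ℝ} (hv : 0 ≤ v) {t : ℝ} (ht0 : 0 < t) (A : Finset (Fin ℓ)) :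
    ((signatureLaw N ℓ v).prod (noiseLaw N))
        {ω | ∑ i, (ω.2 i + ∑ j ∈ A, ω.1 i j) ^ 2 < (1 - t) * N * (1 + A.card * v)} ≤
      ENNReal.ofReal (exp (-(N * (t ^ 2 / 4)))) := by
  set q : ℝ := 1 + A.card * v with hq
  have hq0 : 0 < q := by positivity
  -- Each coordinate has variance `q`; this tilt makes the product of the two determinants from the
  -- integrations over signatures and noise equal to `1 + 2aq = 1 + t`.
  set a : ℝ := t / (2 * q) with ha
  have ha0 : 0 < a := by positivity
  have hσ : ((A.card * v.toNNReal : NNReal) : ℝ) = q - 1 := by simp [hv, hq]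
  have hq1 : 0 ≤ q - 1 := by rw [← hσ]; positivity
  have h1 : 0 < 1 + 2 * a * (q - 1) := by positivity
  have h := chernoff_signature_noise (N := N) (ℓ := ℓ) v
    (f := fun s z => 0 - a * (z + ∑ j ∈ A, s j) ^ 2)
    (by unfold Function.uncurry; fun_prop) (a * ((1 - t) * N * q)) (-(log (1 + t) / 2)) (by
      have e : ∀ z : ℝ, ∫⁻ s, ENNReal.ofReal (exp (0 - a * (z + ∑ j ∈ A, s j) ^ 2))
          ∂(Measure.pi fun _ : Fin ℓ => gaussianReal 0 v.toNNReal) =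
          ENNReal.ofReal (exp (-(log (1 + 2 * a * (q - 1)) / 2) -
            a / (1 + 2 * a * (q - 1)) * (0 + z) ^ 2)) := by
        intro z
        rw [← lintegral_map (f := fun x => ENNReal.ofReal (exp (0 - a * (z + x) ^ 2)))
          (by fun_prop) (by fun_prop), map_sum_gaussian,
          lintegral_exp_sub_mul_sq_gaussianReal _ _ _ _ (by rw [hσ]; exact h1), hσ]
        congr 2
        ring
      simp_rw [e]
      have h2 : 0 < 1 + 2 * (a / (1 + 2 * a * (q - 1))) * ((1 : NNReal) : ℝ) := by positivity
      rw [lintegral_exp_sub_mul_sq_gaussianReal _ _ _ _ h2]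
      congr 2
      have h3 : log (1 + t) = log (1 + 2 * a * (q - 1)) +
          log (1 + 2 * (a / (1 + 2 * a * (q - 1))) * ((1 : NNReal) : ℝ)) := by
        rw [← log_mul h1.ne' h2.ne']
        congr 1
        rw [NNReal.coe_one]
        have : 2 * a * q = t := by rw [ha]; field_simp
        field_simp
        linear_combination -this
      rw [h3]
      ring)
  refine (measure_mono fun ω hω => ?_).trans (h.trans (ENNReal.ofReal_le_ofReal (exp_le_exp.2 ?_)))
  · simp only [Set.mem_ofPred_eq] at hω ⊢
    simp_rw [zero_sub]
    rw [Finset.sum_neg_distrib, ← Finset.mul_sum]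
    have := mul_le_mul_of_nonneg_left hω.le ha0.le
    linarith
  · have hlog : t - t ^ 2 / 2 ≤ log (1 + t) := by
      refine le_trans ?_ (le_log_one_add_of_nonneg ht0.le)
      rw [le_div_iff₀ (by linarith)]
      nlinarith [pow_pos ht0 3]
    have hN : (0 : ℝ) ≤ N := N.cast_nonneg
    have e : a * ((1 - t) * N * q) = N * (t * (1 - t) / 2) := by rw [ha]; field_simp
    rw [e, ← mul_add, ← mul_neg]
    exact mul_le_mul_of_nonneg_left (by nlinarith) hN

/-- Probability that a given alternative is at least as close to the received vector as the
truth. -/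
lemma pairwise_error {v : ℝ} (hv : 0 ≤ v) {A B : Finset (Fin ℓ)} (hAB : Disjoint A B) :
    ((signatureLaw N ℓ v).prod (noiseLaw N))
        {ω | ∑ i, (ω.2 i + ∑ j ∈ A, ω.1 i j - ∑ j ∈ B, ω.1 i j) ^ 2 ≤ ∑ i, ω.2 i ^ 2} ≤
      ENNReal.ofReal (exp (-(N / 2 * log (1 + (A.card + B.card) * v / 4)))) := by
  set p : ℝ := A.card * v with hp
  set q : ℝ := B.card * v with hq
  have hp0 : 0 ≤ p := by positivity
  have hq0 : 0 ≤ q := by positivity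
  have hσA : ((A.card * v.toNNReal : NNReal) : ℝ) = p := by simp [hv, hp]
  have hσB : ((B.card * v.toNNReal : NNReal) : ℝ) = q := by simp [hv, hq]
  have hB : 0 < 1 + 2 * (1 / 4) * q := by positivity
  set a : ℝ := 1 / 4 / (1 + 2 * (1 / 4) * q) with ha
  have ha0 : 0 < a := by positivity
  have hA : 0 < 1 + 2 * a * p := by positivity
  set b : ℝ := a / (1 + 2 * a * p) - 1 / 4 with hb
  have hbv : 1 + 2 * b = (1 + (p + q) / 4) / (1 + (p + q) / 2) := by
    rw [hb, ha]; field_simp; ring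
  have hZ : 0 < 1 + 2 * b * ((1 : NNReal) : ℝ) := by
    rw [NNReal.coe_one, mul_one, hbv]; positivity
  -- The weight `1/4` is optimal: for a fixed signature difference `w`, the mean over `z` of `exp
  -- (λ(z² - (z+w)²))` is `exp ((2λ² - λ)w²)`, smallest at `λ = 1/4`.
  have h := chernoff_signature_noise (N := N) (ℓ := ℓ) v
    (f := fun s z => 1 / 4 * z ^ 2 - 1 / 4 * (-(z + ∑ j ∈ A, s j) + ∑ j ∈ B, s j) ^ 2)
    (by unfold Function.uncurry; fun_prop) 0 (-(log (1 + (p + q) / 4) / 2)) (by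
      have e : ∀ z : ℝ, ∫⁻ s, ENNReal.ofReal
          (exp (1 / 4 * z ^ 2 - 1 / 4 * (-(z + ∑ j ∈ A, s j) + ∑ j ∈ B, s j) ^ 2))
          ∂(Measure.pi fun _ : Fin ℓ => gaussianReal 0 v.toNNReal) =
          ENNReal.ofReal (exp (-(log (1 + 2 * (1 / 4) * q) / 2) - log (1 + 2 * a * p) / 2 -
            b * (0 + z) ^ 2)) := by
        intro z
        rw [lintegral_sum_sum hAB _ (F := fun x y => ENNReal.ofReal
          (exp (1 / 4 * z ^ 2 - 1 / 4 * (-(z + x) + y) ^ 2)))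
          (by unfold Function.uncurry; fun_prop)]
        have e2 : ∀ x : ℝ, ∫⁻ y, ENNReal.ofReal
            (exp (1 / 4 * z ^ 2 - 1 / 4 * (-(z + x) + y) ^ 2))
            ∂(gaussianReal 0 (B.card * v.toNNReal)) = ENNReal.ofReal
            (exp (1 / 4 * z ^ 2 - log (1 + 2 * (1 / 4) * q) / 2 - a * (z + x) ^ 2)) := by
          intro x
          rw [lintegral_exp_sub_mul_sq_gaussianReal _ _ _ _ (by rw [hσB]; exact hB), hσB]
          congr 2
          rw [ha]
          ring
        simp_rw [e2]
        rw [lintegral_exp_sub_mul_sq_gaussianReal _ _ _ _ (by rw [hσA]; exact hA), hσA]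
        congr 2
        rw [hb]
        ring
      simp_rw [e]
      rw [lintegral_exp_sub_mul_sq_gaussianReal _ _ _ _ hZ]
      congr 2
      have h3 : log (1 + (p + q) / 4) = log (1 + 2 * (1 / 4) * q) + log (1 + 2 * a * p) +
          log (1 + 2 * b * ((1 : NNReal) : ℝ)) := by
        rw [← log_mul hB.ne' hA.ne', ← log_mul (by positivity) hZ.ne', NNReal.coe_one, mul_one, hbv,
          ha]
        congr 1
        field_simp
        ring
      rw [h3]
      ring)
  refine (measure_mono fun ω hω => ?_).trans (h.trans (ENNReal.ofReal_le_ofReal (exp_le_exp.2 ?_)))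
  · simp only [Set.mem_ofPred_eq] at hω ⊢
    rw [Finset.sum_sub_distrib, ← Finset.mul_sum, ← Finset.mul_sum]
    have e : ∀ i, (-(ω.2 i + ∑ j ∈ A, ω.1 i j) + ∑ j ∈ B, ω.1 i j) ^ 2 =
        (ω.2 i + ∑ j ∈ A, ω.1 i j - ∑ j ∈ B, ω.1 i j) ^ 2 := fun i => by ring
    simp_rw [e]
    linarith
  · rw [← add_mul]
    apply le_of_eq
    ring

/-- Probability that an alternative is at least as close to the received vector as the truth,
while the noise and the missed part of the signal both have typical norm. -/
lemma typical_pairwise_error {v : ℝ} (hv : 0 ≤ v) {t : ℝ} (ht1 : t < 1)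
    {A B : Finset (Fin ℓ)} (hAB : Disjoint A B) :
    ((signatureLaw N ℓ v).prod (noiseLaw N))
        {ω | ∑ i, (ω.2 i + ∑ j ∈ A, ω.1 i j - ∑ j ∈ B, ω.1 i j) ^ 2 ≤ (1 + t) * N ∧
          (1 - t) * N * (1 + A.card * v) ≤ ∑ i, (ω.2 i + ∑ j ∈ A, ω.1 i j) ^ 2} ≤
      ENNReal.ofReal (exp (-(N / 2 * (log (1 + A.card * v) + log (1 - t) - t)))) := by
  set p : ℝ := A.card * v with hp
  set q : ℝ := B.card * v with hq
  have hp0 : 0 ≤ p := by positivity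
  have hq0 : 0 ≤ q := by positivity
  have hσB : ((B.card * v.toNNReal : NNReal) : ℝ) = q := by simp [hv, hq]
  have hB : 0 < 1 + 2 * (1 / 2) * q := by positivity
  -- With this weight, the factor `exp (-m (z+x)²)` left by integrating out the sum over `B` cancels
  -- against the reward for a large `‖Z + ∑_A‖`. What remains is `(1+q)^(-1/2)` per coordinate.
  set m : ℝ := 1 / 2 / (1 + 2 * (1 / 2) * q) with hm
  have hm0 : 0 < m := by positivity
  have h := chernoff_signature_noise (N := N) (ℓ := ℓ) v
    (f := fun s z => m * (z + ∑ j ∈ A, s j) ^ 2 -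
      1 / 2 * (-(z + ∑ j ∈ A, s j) + ∑ j ∈ B, s j) ^ 2)
    (by unfold Function.uncurry; fun_prop)
    (1 / 2 * ((1 + t) * N) - m * ((1 - t) * N * (1 + p))) (-(log (1 + q) / 2)) (by
      have e : ∀ z : ℝ, ∫⁻ s, ENNReal.ofReal (exp (m * (z + ∑ j ∈ A, s j) ^ 2 -
            1 / 2 * (-(z + ∑ j ∈ A, s j) + ∑ j ∈ B, s j) ^ 2))
          ∂(Measure.pi fun _ : Fin ℓ => gaussianReal 0 v.toNNReal) =
          ENNReal.ofReal (exp (-(log (1 + q) / 2))) := by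
        intro z
        rw [lintegral_sum_sum hAB _ (F := fun x y => ENNReal.ofReal
          (exp (m * (z + x) ^ 2 - 1 / 2 * (-(z + x) + y) ^ 2)))
          (by unfold Function.uncurry; fun_prop)]
        have e2 : ∀ x : ℝ, ∫⁻ y, ENNReal.ofReal
            (exp (m * (z + x) ^ 2 - 1 / 2 * (-(z + x) + y) ^ 2))
            ∂(gaussianReal 0 (B.card * v.toNNReal)) =
            ENNReal.ofReal (exp (-(log (1 + q) / 2))) := by
          intro x
          rw [lintegral_exp_sub_mul_sq_gaussianReal _ _ _ _ (by rw [hσB]; exact hB), hσB]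
          congr 2
          rw [hm]
          ring_nf
        simp_rw [e2]
        simp
      simp_rw [e]
      simp)
  refine (measure_mono fun ω hω => ?_).trans (h.trans (ENNReal.ofReal_le_ofReal (exp_le_exp.2 ?_)))
  · simp only [Set.mem_ofPred_eq] at hω ⊢
    rw [Finset.sum_sub_distrib, ← Finset.mul_sum, ← Finset.mul_sum]
    have e : ∀ i, (-(ω.2 i + ∑ j ∈ A, ω.1 i j) + ∑ j ∈ B, ω.1 i j) ^ 2 =
        (ω.2 i + ∑ j ∈ A, ω.1 i j - ∑ j ∈ B, ω.1 i j) ^ 2 := fun i => by ring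
    simp_rw [e]
    have := mul_le_mul_of_nonneg_left hω.2 hm0.le
    linarith [hω.1]
  · have hN : (0 : ℝ) ≤ N := N.cast_nonneg
    have ht : 0 < 1 - t := by linarith
    have hu : 0 < (1 - t) * (1 + p) / (1 + q) := by positivity
    -- The inequality `log u ≤ u - 1` removes `q`: the bound is uniform in the size of `B`.
    have hlog := log_le_sub_one_of_pos hu
    rw [log_div (by positivity) (by positivity), log_mul (by positivity) (by positivity)] at hlog
    have e : m * ((1 - t) * N * (1 + p)) = N / 2 * ((1 - t) * (1 + p) / (1 + q)) := by
      rw [hm]; field_simp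
    rw [e]
    have := mul_le_mul_of_nonneg_left hlog (by positivity : (0 : ℝ) ≤ N / 2)
    linarith

end GaussianEvents

/-! ### Counting candidate supports -/

section Counting

open Real

variable {ι : Type*}

/-- Chernoff-type bound for the number of small subsets of a finite set. -/
lemma card_le_mul_pow (s : Finset ι) (𝒞 : Finset (Finset ι)) {m x : ℝ} (hx : 0 ≤ x)
    (h : ∀ B ∈ 𝒞, B ⊆ s ∧ (B.card : ℝ) ≤ m) :
    (𝒞.card : ℝ) ≤ exp (x * m) * (1 + exp (-x)) ^ s.card := by
  have h1 : (𝒞.card : ℝ) * exp (-(x * m)) ≤ (1 + exp (-x)) ^ s.card := by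
    calc (𝒞.card : ℝ) * exp (-(x * m)) = ∑ _B ∈ 𝒞, exp (-(x * m)) := by simp
      _ ≤ ∑ B ∈ 𝒞, exp (-x) ^ B.card := by
        refine Finset.sum_le_sum fun B hB => ?_
        rw [← exp_nat_mul, exp_le_exp]
        nlinarith [mul_le_mul_of_nonneg_left (h B hB).2 hx]
      _ ≤ ∑ B ∈ s.powerset, exp (-x) ^ B.card := by
        refine Finset.sum_le_sum_of_subset_of_nonneg
          (fun B hB => Finset.mem_powerset.2 (h B hB).1) fun B _ _ => by positivity
      _ = (1 + exp (-x)) ^ s.card := by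
        rw [add_comm, ← Finset.sum_pow_mul_eq_add_pow]
        simp
  rw [exp_neg, ← div_eq_mul_inv, div_le_iff₀ (exp_pos _)] at h1
  linarith

/-- Weakens `card_le_mul_pow` by `1 + y ≤ exp y`; the result is convenient for sets much smaller
than `s`. -/
lemma card_le_exp (s : Finset ι) (𝒞 : Finset (Finset ι)) {m x : ℝ} (hx : 0 ≤ x)
    (h : ∀ B ∈ 𝒞, B ⊆ s ∧ (B.card : ℝ) ≤ m) :
    (𝒞.card : ℝ) ≤ exp (x * m + s.card * exp (-x)) := by
  refine (card_le_mul_pow s 𝒞 hx h).trans ?_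
  rw [exp_add, exp_nat_mul]
  gcongr
  linarith [add_one_le_exp (exp (-x))]

/-- Apply `log u ≤ u - 1` to `u = 1/√x`, since `log (1/x) = 2 log (1/√x)`. -/
lemma mul_log_inv_le {x : ℝ} (hx : 0 < x) : x * log x⁻¹ ≤ 2 * √x - 2 * x := by
  have h0 : 0 < √x := sqrt_pos.2 hx
  have h1 : log x⁻¹ = 2 * log (√x)⁻¹ := by
    rw [log_inv, log_inv, log_sqrt hx.le]; ring
  have h2 := log_le_sub_one_of_pos (inv_pos.2 h0)
  have h3 : x * (√x)⁻¹ = √x := by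
    rw [mul_inv_eq_iff_eq_mul₀ h0.ne', mul_self_sqrt hx.le]
  rw [h1]
  nlinarith

/-- Number of subsets that contain all but a small fraction `η` of a finite set. -/
lemma card_large_subsets_le [DecidableEq ι] (T : Finset ι) {η : ℝ} (hη0 : 0 < η) (hη1 : η ≤ 1) :
    ((T.powerset.filter fun A => (1 - η) * (T.card : ℝ) ≤ A.card).card : ℝ) ≤
      exp (2 * √η * T.card) := by
  have hx : 0 ≤ log η⁻¹ := log_nonneg ((one_le_inv₀ hη0).2 hη1)
  -- Count the complements in `T`, which have size at most `η |T|`, with tilt `log (1/η)`.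
  have h := card_le_exp T ((T.powerset.filter fun A => (1 - η) * (T.card : ℝ) ≤ A.card).image
    fun A => T \ A) (m := η * T.card) hx (by
      intro B hB
      simp only [Finset.mem_image, Finset.mem_filter, Finset.mem_powerset] at hB
      obtain ⟨A, ⟨hA, hc⟩, rfl⟩ := hB
      refine ⟨Finset.sdiff_subset, ?_⟩
      rw [Finset.card_sdiff_of_subset hA, Nat.cast_sub (Finset.card_le_card hA)]
      linarith)
  rw [Finset.card_image_of_injOn] at h
  · refine h.trans (exp_le_exp.2 ?_)
    rw [← log_inv, inv_inv, exp_log hη0]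
    have := mul_log_inv_le hη0
    have hT : (0 : ℝ) ≤ T.card := Nat.cast_nonneg _
    nlinarith
  · intro A hA A' hA' h
    simp only [Finset.coe_filter, Finset.mem_powerset, Set.mem_ofPred_eq] at hA hA'
    have h : T \ A = T \ A' := h
    rw [← Finset.sdiff_sdiff_eq_self hA.1, h, Finset.sdiff_sdiff_eq_self hA'.1]

/-- The tilt `x = log ((1-a)/a)`, nonnegative because `a ≤ 1/2`, gives exactly the entropy at `m = a
|s|`; each further unit of size costs at most `log (1/a)`. -/
lemma card_le_exp_binEntropy (s : Finset ι) (𝒞 : Finset (Finset ι)) {m a : ℝ} (ha0 : 0 < a)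
    (ha : a ≤ 1 / 2) (h : ∀ B ∈ 𝒞, B ⊆ s ∧ (B.card : ℝ) ≤ m) (hm : a * s.card ≤ m) :
    (𝒞.card : ℝ) ≤ exp (s.card * binEntropy a + (m - a * s.card) * log a⁻¹) := by
  have ha1 : 0 < 1 - a := by linarith
  have hx : 0 ≤ log ((1 - a) / a) := log_nonneg (by rw [le_div_iff₀ ha0]; linarith)
  refine (card_le_mul_pow s 𝒞 hx h).trans ?_
  rw [← log_inv, exp_log (by positivity), inv_div]
  have e : 1 + a / (1 - a) = exp (-log (1 - a)) := by
    rw [exp_neg, exp_log ha1]; field_simp; ring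
  rw [e, ← exp_nat_mul, ← exp_add, exp_le_exp, log_div ha1.ne' ha0.ne', binEntropy, log_inv,
    log_inv]
  have : log (1 - a) ≤ 0 := log_nonpos ha1.le (by linarith)
  nlinarith

/-- The tilt is `log (1/a)`. No condition `a ≤ 1/2` is needed, at the price of the extra term `a
|s|`. -/
lemma card_le_exp_log_inv (s : Finset ι) (𝒞 : Finset (Finset ι)) {m a : ℝ} (ha0 : 0 < a)
    (ha : a ≤ 1) (h : ∀ B ∈ 𝒞, B ⊆ s ∧ (B.card : ℝ) ≤ m) :
    (𝒞.card : ℝ) ≤ exp (m * log a⁻¹ + a * s.card) := by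
  refine (card_le_exp s 𝒞 (log_nonneg ((one_le_inv₀ ha0).2 ha)) h).trans_eq ?_
  rw [← log_inv, inv_inv, exp_log ha0]
  ring_nf

/-- For fixed `T`, the pair `(T \ U, U \ T)` determines `U`. -/
lemma card_le_card_mul_card_of_sdiff [DecidableEq ι] (T : Finset ι)
    (𝒰 𝒜 ℬ : Finset (Finset ι)) (h : ∀ U ∈ 𝒰, T \ U ∈ 𝒜 ∧ U \ T ∈ ℬ) :
    𝒰.card ≤ 𝒜.card * ℬ.card := by
  rw [← Finset.card_product]
  refine Finset.card_le_card_of_injOn (fun U => (T \ U, U \ T))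
    (fun U hU => Finset.mem_product.2 (h U hU)) fun U _ V _ hUV => ?_
  simp only [Prod.mk.injEq] at hUV
  ext j
  have h1 := Finset.ext_iff.1 hUV.1 j
  have h2 := Finset.ext_iff.1 hUV.2 j
  simp only [Finset.mem_sdiff] at h1 h2
  tauto

/-- Number of sets at a given Hamming distance `w` from `T`. -/
lemma card_sphere_le [Fintype ι] [DecidableEq ι] (T : Finset ι) {w : ℕ} (hw : 0 < w) {a k : ℝ}
    (ha0 : 0 < a) (ha1 : a ≤ 1) (hk : k = a * Fintype.card ι) (hwk : (w : ℝ) ≤ k)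
    (hT : (T.card : ℝ) ≤ 2 * k) (𝒰 : Finset (Finset ι))
    (h𝒰 : ∀ U ∈ 𝒰, (T \ U).card + (U \ T).card = w) :
    (𝒰.card : ℝ) ≤ exp (w * log a⁻¹ + 4 * √(w * k)) := by
  have hw0 : (0 : ℝ) < w := by exact_mod_cast hw
  have hk0 : 0 < k := hw0.trans_le hwk
  have hx1 : 0 ≤ log (k / w) := log_nonneg ((one_le_div hw0).2 hwk)
  have hx2 : 0 ≤ log a⁻¹ := log_nonneg ((one_le_inv₀ ha0).2 ha1)
  -- The tilts are the logarithms of `k/w` for `T \ U` and of `ℓ/w = (k/w)(1/a)` for `U \ T`. The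
  -- terms `2w log (k/w) + 3w` are then absorbed by `mul_log_inv_le` at `w/k`.
  have h1 := card_le_exp T (T.powerset.filter fun A => (A.card : ℝ) ≤ w) (m := w) hx1
    (by simp +contextual)
  have h2 := card_le_exp Finset.univ ((Finset.univ : Finset (Finset ι)).filter
    fun A => (A.card : ℝ) ≤ w) (m := w) (add_nonneg hx1 hx2) (by simp +contextual)
  have h3 := card_le_card_mul_card_of_sdiff T 𝒰 (T.powerset.filter fun A => (A.card : ℝ) ≤ w)
    ((Finset.univ : Finset (Finset ι)).filter fun A => (A.card : ℝ) ≤ w) (by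
      intro U hU
      have := h𝒰 U hU
      simp only [Finset.mem_filter, Finset.mem_powerset, Finset.sdiff_subset, true_and,
        Finset.mem_univ, Nat.cast_le]
      omega)
  have h4 : (𝒰.card : ℝ) ≤ _ := (Nat.cast_le.2 h3).trans
    ((Nat.cast_mul _ _).trans_le (mul_le_mul h1 h2 (Nat.cast_nonneg _) (exp_pos _).le))
  refine h4.trans ?_
  rw [← exp_add, exp_le_exp, neg_add, exp_add, ← log_inv, ← log_inv, exp_log (by positivity),
    exp_log (by positivity), inv_inv, inv_div, Finset.card_univ]
  have e1 : (Fintype.card ι : ℝ) * (w / k * a) = w := by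
    rw [hk] at hk0 ⊢
    have : (Fintype.card ι : ℝ) ≠ 0 := by rintro h; simp [h] at hk0
    field_simp
  have e2 : (T.card : ℝ) * (w / k) ≤ 2 * w := by
    calc (T.card : ℝ) * (w / k) ≤ 2 * k * (w / k) := by gcongr
      _ = 2 * w := by field_simp
  have e3 := mul_log_inv_le (div_pos hw0 hk0)
  rw [inv_div] at e3
  have e4 : k * √(w / k) = √(w * k) := by
    rw [← sqrt_sq hk0.le, ← sqrt_mul (sq_nonneg k), sqrt_sq hk0.le]
    congr 1
    field_simp
  have e5 : w * log (k / w) ≤ 2 * √(w * k) - 2 * w := by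
    have := mul_le_mul_of_nonneg_left e3 hk0.le
    have e6 : k * (w / k * log (k / w)) = w * log (k / w) := by field_simp
    have e7 : k * (2 * √(w / k) - 2 * (w / k)) = 2 * √(w * k) - 2 * w := by
      rw [← e4]; field_simp
    linarith
  nlinarith

end Counting

/-! ### Concentration of the number of active users -/

section Activity

open Real

/-- By `1 + y ≤ exp y`, the exponential moment is at most that of a Poisson variable of mean `a`. -/
lemma lintegral_exp_bernoulli_le (a : unitInterval) (s : ℝ) :
    ∫⁻ x, ENNReal.ofReal (exp (s * if x = true then 1 else 0)) ∂(bernoulliMeasure true false a) ≤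
      ENNReal.ofReal (exp (a * (exp s - 1))) := by
  have e : ∫⁻ x, ENNReal.ofReal (exp (s * if x = true then 1 else 0))
      ∂(bernoulliMeasure true false a) = ENNReal.ofReal (a * exp s + (1 - a)) := by
    have ha1 : (0 : ℝ) ≤ 1 - a := sub_nonneg.2 a.2.2
    rw [bernoulliMeasure_def, lintegral_add_measure, lintegral_smul_measure,
      lintegral_smul_measure, lintegral_dirac, lintegral_dirac,
      ENNReal.ofReal_add (mul_nonneg a.2.1 (exp_pos _).le) ha1, ENNReal.ofReal_mul a.2.1]
    have h1 : ENNReal.ofReal (a : ℝ) = (unitInterval.toNNReal a : ENNReal) := by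
      rw [← ENNReal.ofReal_coe_nnreal]; rfl
    have h2 : ENNReal.ofReal (1 - (a : ℝ)) =
        (unitInterval.toNNReal (unitInterval.symm a) : ENNReal) := by
      rw [← ENNReal.ofReal_coe_nnreal]; rfl
    rw [h1, h2]
    simp [ENNReal.smul_def]
  rw [e]
  refine ENNReal.ofReal_le_ofReal ?_
  linarith [add_one_le_exp ((a : ℝ) * (exp s - 1))]

variable {ℓ : ℕ}

lemma supportSize_eq_sum (x : Fin ℓ → Bool) :
    (supportSize x : ℝ) = ∑ j, if x j = true then (1 : ℝ) else 0 := by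
  simp [supportSize]

lemma activity_chernoff (a : unitInterval) (s C : ℝ) :
    activityLaw ℓ a {x | 0 ≤ C + s * supportSize x} ≤
      ENNReal.ofReal (exp (C + a * ℓ * (exp s - 1))) := by
  -- There is no second variable here, so its law is a point mass on `Unit`.
  have h := chernoff_pi_prod (N := ℓ) (bernoulliMeasure true false a) (Measure.dirac ())
    (f := fun x _ => s * if x = true then 1 else 0) (by fun_prop) C
  have e : {ω : (Fin ℓ → Bool) × (Fin ℓ → Unit) |
      0 ≤ C + ∑ i, (fun x (_ : Unit) => s * if x = true then 1 else 0) (ω.1 i) (ω.2 i)} =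
      {x | 0 ≤ C + s * supportSize x} ×ˢ Set.univ := by
    ext ω
    simp only [Set.mem_ofPred_eq, Set.mem_prod, Set.mem_univ, and_true, supportSize_eq_sum,
      Finset.mul_sum]
  rw [e, Measure.prod_prod, measure_univ, mul_one] at h
  refine h.trans ?_
  simp only [lintegral_const, measure_univ, mul_one]
  calc _ ≤ ENNReal.ofReal (exp C) * ENNReal.ofReal (exp (a * (exp s - 1))) ^ ℓ := by
        gcongr
        exact lintegral_exp_bernoulli_le a s
    _ = _ := by
        rw [ofReal_exp_mul_pow]
        ring_nf

/-- The number of active users is concentrated around its mean. -/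
lemma activity_concentration (a : unitInterval) {d k : ℝ} (hd0 : 0 < d) (hd1 : d ≤ 1)
    (hk : k = a * ℓ) :
    activityLaw ℓ a {x | (supportSize x : ℝ) < (1 - d) * k ∨ (1 + d) * k < supportSize x} ≤
      2 * ENNReal.ofReal (exp (-(k * d ^ 2 / 4))) := by
  have hk0 : 0 ≤ k := by rw [hk]; exact mul_nonneg a.2.1 (Nat.cast_nonneg _)
  have hexp : ∀ s : ℝ, |s| ≤ 1 → exp s - 1 ≤ s + s ^ 2 := fun s hs => by
    have := (abs_le.1 (abs_exp_sub_one_sub_id_le hs)).2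
    linarith
  -- The tilts `± d/2` minimise the exponent `-(s d) k + s² k` coming from `exp s - 1 ≤ s + s²`.
  have h1 := activity_chernoff (ℓ := ℓ) a (d / 2) (-(d / 2 * ((1 + d) * k)))
  have h2 := activity_chernoff (ℓ := ℓ) a (-(d / 2)) (d / 2 * ((1 - d) * k))
  rw [← hk] at h1 h2
  have b1 := mul_le_mul_of_nonneg_left (hexp (d / 2) (by rw [abs_of_pos (by linarith)]; linarith)) hk0
  have b2 := mul_le_mul_of_nonneg_left
    (hexp (-(d / 2)) (by rw [abs_neg, abs_of_pos (by linarith)]; linarith)) hk0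
  rw [Set.ofPred_or, two_mul, add_comm]
  refine (measure_union_le _ _).trans ?_
  rw [add_comm]
  refine add_le_add ((measure_mono fun x hx => ?_).trans
    (h1.trans (ENNReal.ofReal_le_ofReal (exp_le_exp.2 ?_))))
    ((measure_mono fun x hx => ?_).trans
      (h2.trans (ENNReal.ofReal_le_ofReal (exp_le_exp.2 ?_))))
  · simp only [Set.mem_ofPred_eq] at hx ⊢
    nlinarith
  · nlinarith
  · simp only [Set.mem_ofPred_eq] at hx ⊢
    nlinarith
  · nlinarith

end Activity

/-! ### Union bounds over near, far and nearly disjoint supports -/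

section UnionBound

open Real

variable {N ℓ : ℕ}

/-- Signatures and noise for which the support `U` fits the received vector at least as well as
the true support `T`. -/
def confusable (N : ℕ) (T U : Finset (Fin ℓ)) : Set ((Fin N → Fin ℓ → ℝ) × (Fin N → ℝ)) :=
  {ω | ∑ i, (ω.2 i + ∑ j ∈ T \ U, ω.1 i j - ∑ j ∈ U \ T, ω.1 i j) ^ 2 ≤ ∑ i, ω.2 i ^ 2}

lemma measure_biUnion_le_exp {Ω κ : Type*} [MeasurableSpace Ω] (μ : Measure Ω) (𝒞 : Finset κ)
    (W : κ → Set Ω) {Q E : ℝ} (hQ : (𝒞.card : ℝ) ≤ exp Q)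
    (hW : ∀ U ∈ 𝒞, μ (W U) ≤ ENNReal.ofReal (exp E)) :
    μ (⋃ U ∈ 𝒞, W U) ≤ ENNReal.ofReal (exp (Q + E)) := by
  calc μ (⋃ U ∈ 𝒞, W U) ≤ ∑ U ∈ 𝒞, μ (W U) := measure_biUnion_finset_le _ _
    _ ≤ ∑ _U ∈ 𝒞, ENNReal.ofReal (exp E) := Finset.sum_le_sum hW
    _ = ENNReal.ofReal (𝒞.card * exp E) := by
      rw [Finset.sum_const, nsmul_eq_mul, ENNReal.ofReal_mul (Nat.cast_nonneg _),
        ENNReal.ofReal_natCast]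
    _ ≤ _ := ENNReal.ofReal_le_ofReal (by rw [exp_add]; gcongr)

lemma measure_confusable_le {v : ℝ} (hv : 0 ≤ v) (T U : Finset (Fin ℓ)) {w : ℝ} (hw : 0 ≤ w)
    (h : w ≤ (T \ U).card + (U \ T).card) :
    ((signatureLaw N ℓ v).prod (noiseLaw N)) (confusable N T U) ≤
      ENNReal.ofReal (exp (-(N / 2 * log (1 + w * v / 4)))) := by
  refine (pairwise_error hv disjoint_sdiff_sdiff).trans (ENNReal.ofReal_le_ofReal ?_)
  gcongr

/-- A concave function vanishing at zero lies above its chords from zero. This transfers a bound at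
distance `ζ k` to every smaller distance. -/
lemma concave_log_one_add_mul {x y c : ℝ} (hc : 0 ≤ c) (hx : 0 ≤ x) (hxy : x ≤ y) (hy : 0 < y) :
    x / y * log (1 + y * c) ≤ log (1 + x * c) := by
  have h := strictConcaveOn_log_Ioi.concaveOn.2 (Set.mem_Ioi.2 one_pos)
    (Set.mem_Ioi.2 (by positivity : 0 < 1 + y * c)) (sub_nonneg.2 ((div_le_one hy).2 hxy))
    (by positivity : 0 ≤ x / y) (by ring)
  simp only [smul_eq_mul, log_one, mul_zero, zero_add] at h
  refine h.trans_eq ?_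
  congr 1
  field_simp
  ring

/-- Errors at small Hamming distance. -/
lemma measure_near_le {v a k C ζ L : ℝ} (hv : 0 < v) (ha0 : 0 < a) (ha1 : a ≤ 1)
    (hk : k = a * ℓ) (hk0 : 0 < k) {T : Finset (Fin ℓ)} (hT : (T.card : ℝ) ≤ 2 * k) (hζ0 : 0 < ζ)
    (hζ1 : ζ ≤ 1) (hkN : k ≤ C * N) (hent : k * log a⁻¹ ≤ N / 2 * L)
    (hL : 4 * ζ * L ≤ log (1 + ζ * k * v / 4)) (hζC : 8 * C * √ζ ≤ log (1 + v / 4) / 4) :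
    ((signatureLaw N ℓ v).prod (noiseLaw N))
        {ω | ∃ U : Finset (Fin ℓ), U ≠ T ∧ ((T \ U).card + (U \ T).card : ℝ) ≤ ζ * k ∧
          ω ∈ confusable N T U} ≤
      ENNReal.ofReal (exp (log k - N / 4 * log (1 + v / 4))) := by
  have hNn : (0 : ℝ) ≤ N := N.cast_nonneg
  have hsub : {ω | ∃ U : Finset (Fin ℓ), U ≠ T ∧ ((T \ U).card + (U \ T).card : ℝ) ≤ ζ * k ∧
      ω ∈ confusable N T U} ⊆ ⋃ w ∈ Finset.Icc 1 ⌊ζ * k⌋₊,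
        ⋃ U ∈ (Finset.univ : Finset (Finset (Fin ℓ))).filter
          fun U => (T \ U).card + (U \ T).card = w, confusable N T U := by
    rintro ω ⟨U, hUT, hw, hω⟩
    simp only [Set.mem_iUnion, Finset.mem_filter, Finset.mem_univ, true_and, exists_prop,
      Finset.mem_Icc]
    refine ⟨_, ⟨?_, Nat.le_floor (by exact_mod_cast hw)⟩, U, rfl, hω⟩
    by_contra h0
    push Not at h0
    have h1 : (T \ U).card = 0 ∧ (U \ T).card = 0 := by omega
    rw [Finset.card_eq_zero, Finset.card_eq_zero, Finset.sdiff_eq_empty_iff_subset,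
      Finset.sdiff_eq_empty_iff_subset] at h1
    exact hUT (h1.2.antisymm h1.1)
  refine (measure_mono hsub).trans ?_
  rw [sub_eq_add_neg]
  refine measure_biUnion_le_exp _ _ _ ?_ fun w hw => ?_
  · rw [exp_log hk0, Nat.card_Icc, Nat.add_sub_cancel]
    exact (Nat.floor_le (by positivity)).trans (by nlinarith)
  · rw [Finset.mem_Icc] at hw
    have hw0 : (1 : ℝ) ≤ w := by exact_mod_cast hw.1
    have hwζ : (w : ℝ) ≤ ζ * k := (Nat.le_floor_iff (by positivity)).1 hw.2
    have hwk : (w : ℝ) ≤ k := hwζ.trans (by nlinarith)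
    refine (measure_biUnion_le_exp _ _ _ (card_sphere_le T hw.1 ha0 ha1 (by simpa using hk) hwk hT _
      (by simp)) fun U hU => measure_confusable_le (w := w) hv.le T U (by positivity) ?_).trans
      (ENNReal.ofReal_le_ofReal (exp_le_exp.2 ?_))
    · simp only [Finset.mem_filter] at hU
      exact_mod_cast hU.2.ge
    · set Λ := log (1 + w * v / 4) with hΛ
      have hΛ1 : log (1 + v / 4) ≤ Λ := by
        apply log_le_log (by positivity)
        nlinarith
      -- Each of the two counting terms, `w log (1/a)` and `4 √(wk)`, will use at most `(N/8) Λ` of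
      -- the exponent `(N/2) Λ`, leaving `(N/4) Λ`.
      have h1 := concave_log_one_add_mul (x := w) (y := ζ * k) (c := v / 4) (by positivity)
        (by positivity) hwζ (by positivity)
      rw [← mul_div_assoc, ← mul_div_assoc, ← hΛ] at h1
      have h2 : w * log a⁻¹ ≤ N / 8 * Λ := by
        calc w * log a⁻¹ = w / k * (k * log a⁻¹) := by field_simp
          _ ≤ w / k * (N / 2 * L) := by gcongr
          _ = N / 8 * (w / (ζ * k) * (4 * ζ * L)) := by field_simp; ring
          _ ≤ N / 8 * (w / (ζ * k) * log (1 + ζ * k * v / 4)) := by gcongr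
          _ ≤ N / 8 * Λ := by gcongr
      have h3 : 4 * √(w * k) ≤ N / 8 * Λ := by
        have h4 : √(w * k) ≤ √ζ * k := by
          rw [← sqrt_sq hk0.le, ← sqrt_mul hζ0.le, sqrt_sq hk0.le]
          apply sqrt_le_sqrt
          nlinarith
        have h5 : √ζ * k ≤ √ζ * (C * N) := by gcongr
        nlinarith [mul_le_mul_of_nonneg_left hζC hNn]
      nlinarith

/-- Errors at large Hamming distance that still catch a fraction of the active users. -/
lemma measure_far_le {v a k d ζ η : ℝ} (hv : 0 < v) (ha0 : 0 < a) (ha1 : a ≤ 1)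
    (hk : k = a * ℓ) (hk0 : 0 < k) (hζ0 : 0 < ζ) (hη0 : 0 < η) (hη1 : η ≤ 1) (hd0 : 0 < d)
    (hd : 8 * d ≤ η) {T : Finset (Fin ℓ)} (hT1 : (1 - d) * k ≤ T.card)
    (hT2 : (T.card : ℝ) ≤ (1 + d) * k) :
    ((signatureLaw N ℓ v).prod (noiseLaw N))
        {ω | ∃ U : Finset (Fin ℓ), ζ * k ≤ ((T \ U).card + (U \ T).card : ℝ) ∧
          ((T \ U).card : ℝ) ≤ (1 - η) * T.card ∧ (U.card : ℝ) ≤ (1 + 2 * d) * k ∧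
          ω ∈ confusable N T U} ≤
      ENNReal.ofReal (exp ((1 - η / 2) * (k * log a⁻¹) + 3 * k -
        N / 2 * log (1 + ζ * k * v / 4))) := by
  set 𝒰 := (Finset.univ : Finset (Finset (Fin ℓ))).filter fun U =>
    ζ * k ≤ ((T \ U).card + (U \ T).card : ℝ) ∧
      ((T \ U).card : ℝ) ≤ (1 - η) * T.card ∧ (U.card : ℝ) ≤ (1 + 2 * d) * k with h𝒰
  have hsub : {ω | ∃ U : Finset (Fin ℓ), ζ * k ≤ ((T \ U).card + (U \ T).card : ℝ) ∧
          ((T \ U).card : ℝ) ≤ (1 - η) * T.card ∧ (U.card : ℝ) ≤ (1 + 2 * d) * k ∧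
          ω ∈ confusable N T U} ⊆ ⋃ U ∈ 𝒰, confusable N T U := by
    rintro ω ⟨U, h1, h2, h3, h4⟩
    simp only [Set.mem_iUnion, exists_prop]
    exact ⟨U, by simp [h𝒰, h1, h2, h3], h4⟩
  refine (measure_mono hsub).trans ?_
  rw [sub_eq_add_neg]
  refine measure_biUnion_le_exp _ _ _ ?_ fun U hU =>
    measure_confusable_le hv.le T U (by positivity) (Finset.mem_filter.1 hU).2.1
  -- Since `|U \ T| = |T \ U| + |U| - |T|`, catching a fraction `η` of `T` forces `|U \ T| ≤ (1 - η
  -- + 4d) k`, and `8d ≤ η` gives `(1 - η/2) k`. The set `T \ U` is counted trivially, as any subset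
  -- of `T`.
  have hB := card_le_exp_log_inv Finset.univ ((Finset.univ : Finset (Finset (Fin ℓ))).filter
    fun B => (B.card : ℝ) ≤ (1 - η / 2) * k) (m := (1 - η / 2) * k) ha0 ha1 (by simp +contextual)
  have hcard := card_le_card_mul_card_of_sdiff T 𝒰 T.powerset
    ((Finset.univ : Finset (Finset (Fin ℓ))).filter fun B => (B.card : ℝ) ≤ (1 - η / 2) * k) (by
      intro U hU
      obtain ⟨-, h1, h2, h3⟩ := Finset.mem_filter.1 hU
      refine ⟨Finset.mem_powerset.2 Finset.sdiff_subset, Finset.mem_filter.2 ⟨Finset.mem_univ _, ?_⟩⟩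
      have e1 : ((U \ T).card : ℝ) + T.card = (T \ U).card + U.card := by
        have e2 := Finset.card_sdiff_add_card U T
        have e3 := Finset.card_sdiff_add_card T U
        rw [Finset.union_comm] at e3
        exact_mod_cast e2.trans e3.symm
      have : (1 - η) * (T.card : ℝ) ≤ (1 - η) * ((1 + d) * k) :=
        mul_le_mul_of_nonneg_left hT2 (by linarith)
      have : 8 * d * k ≤ η * k := by gcongr
      have : 0 ≤ η * d * k := by positivity
      nlinarith)
  have h2K : (T.powerset.card : ℝ) ≤ exp (2 * k) := by
    rw [Finset.card_powerset, Nat.cast_pow, Nat.cast_ofNat]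
    calc (2 : ℝ) ^ T.card ≤ exp 1 ^ T.card := by
          gcongr
          linarith [add_one_le_exp (1 : ℝ)]
      _ = exp T.card := by rw [← exp_nat_mul, mul_one]
      _ ≤ _ := exp_le_exp.2 (by nlinarith)
  refine (Nat.cast_le.2 hcard).trans ((Nat.cast_mul _ _).trans_le
    ((mul_le_mul h2K hB (Nat.cast_nonneg _) (exp_pos _).le).trans_eq ?_))
  rw [← exp_add, Finset.card_univ, Fintype.card_fin, ← hk]
  congr 1
  ring

/-- Errors that miss nearly all active users. -/
lemma measure_missing_le {v k d η t Q : ℝ} (hv : 0 < v) (hη0 : 0 < η) (hη1 : η ≤ 1 / 2)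
    (ht0 : 0 < t) (ht1 : t < 1) (hd0 : 0 < d) (hd : d ≤ η) (hk0 : 0 < k) {T : Finset (Fin ℓ)}
    (hT1 : (1 - d) * k ≤ T.card) (hT2 : (T.card : ℝ) ≤ 2 * k)
    (hQ : ((((Finset.univ : Finset (Finset (Fin ℓ))).filter
      fun B => (B.card : ℝ) ≤ (1 + 2 * d) * k).card : ℕ) : ℝ) ≤ exp Q) :
    ((signatureLaw N ℓ v).prod (noiseLaw N))
        {ω | ∃ U : Finset (Fin ℓ), (1 - η) * T.card ≤ ((T \ U).card : ℝ) ∧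
          (U.card : ℝ) ≤ (1 + 2 * d) * k ∧ ω ∈ confusable N T U} ≤
      ENNReal.ofReal (exp (-(N * (t ^ 2 / 16)))) +
        (ENNReal.ofReal (exp (4 * √η * k + -(N * (t ^ 2 / 4)))) +
          ENNReal.ofReal (exp (4 * √η * k + (Q +
            -(N / 2 * (log (1 + (1 - 2 * η) * k * v) + log (1 - t) - t)))))) := by
  set 𝒜 := T.powerset.filter fun A => (1 - η) * (T.card : ℝ) ≤ A.card with h𝒜
  set ℬ := (Finset.univ : Finset (Finset (Fin ℓ))).filter
      fun B => (B.card : ℝ) ≤ (1 + 2 * d) * k with hℬ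
  set V : Finset (Fin ℓ) → Finset (Fin ℓ) → Set ((Fin N → Fin ℓ → ℝ) × (Fin N → ℝ)) :=
    fun A B => {ω | Disjoint A B ∧
      ∑ i, (ω.2 i + ∑ j ∈ A, ω.1 i j - ∑ j ∈ B, ω.1 i j) ^ 2 ≤ (1 + t) * N ∧
          (1 - t) * N * (1 + A.card * v) ≤ ∑ i, (ω.2 i + ∑ j ∈ A, ω.1 i j) ^ 2} with hV
  have hA : (𝒜.card : ℝ) ≤ exp (4 * √η * k) := by
    refine (card_large_subsets_le T hη0 (by linarith)).trans (exp_le_exp.2 ?_)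
    nlinarith [sqrt_nonneg η]
  -- The norm events depend on nothing or on `A = T \ U` only, so the large number of sets `B = U \
  -- T` is paid for only by the sharp pairwise bound.
  have hsub : {ω | ∃ U : Finset (Fin ℓ), (1 - η) * T.card ≤ ((T \ U).card : ℝ) ∧
      (U.card : ℝ) ≤ (1 + 2 * d) * k ∧ ω ∈ confusable N T U} ⊆
      {ω | (1 + t) * N < ∑ i, ω.2 i ^ 2} ∪
        ((⋃ A ∈ 𝒜, {ω | ∑ i, (ω.2 i + ∑ j ∈ A, ω.1 i j) ^ 2 < (1 - t) * N * (1 + A.card * v)}) ∪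
          ⋃ A ∈ 𝒜, ⋃ B ∈ ℬ, V A B) := by
    rintro ω ⟨U, h1, h2, h3⟩
    have hmA : T \ U ∈ 𝒜 := by simp [h𝒜, h1]
    by_cases hz : (1 + t) * N < ∑ i, ω.2 i ^ 2
    · exact Or.inl hz
    by_cases hs : ∑ i, (ω.2 i + ∑ j ∈ T \ U, ω.1 i j) ^ 2 < (1 - t) * N * (1 + (T \ U).card * v)
    · exact Or.inr (Or.inl (Set.mem_biUnion hmA hs))
    · refine Or.inr (Or.inr (Set.mem_biUnion hmA (Set.mem_biUnion (x := U \ T) ?_ ?_)))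
      · have : ((U \ T).card : ℝ) ≤ U.card := by exact_mod_cast Finset.card_le_card Finset.sdiff_subset
        simp only [hℬ, Finset.coe_filter, Finset.mem_univ, true_and, Set.mem_ofPred_eq]
        linarith
      · exact ⟨disjoint_sdiff_sdiff, le_trans h3 (not_lt.1 hz), not_lt.1 hs⟩
  refine (measure_mono hsub).trans ((measure_union_le _ _).trans (add_le_add
    (noise_norm_tail v ht0 ht1.le) ((measure_union_le _ _).trans (add_le_add ?_ ?_))))
  · exact measure_biUnion_le_exp _ _ _ hA fun A _ => signal_norm_tail hv.le ht0 A
  · refine measure_biUnion_le_exp _ _ _ hA fun A hAm => measure_biUnion_le_exp _ _ _ hQ fun B _ => ?_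
    by_cases hAB : Disjoint A B
    · refine (measure_mono fun ω hω => hω.2).trans
        ((typical_pairwise_error hv.le ht1 hAB).trans (ENNReal.ofReal_le_ofReal (exp_le_exp.2 ?_)))
      have hAc : (1 - 2 * η) * k ≤ A.card := by
        have h1 := (Finset.mem_filter.1 hAm).2
        have h2 : (1 - η) * ((1 - d) * k) ≤ (1 - η) * T.card :=
          mul_le_mul_of_nonneg_left hT1 (by linarith)
        have h3 : d * k ≤ η * k := by gcongr
        have : 0 ≤ η * d * k := by positivity
        nlinarith
      have h0 : 0 ≤ (1 - 2 * η) * k := mul_nonneg (by linarith) hk0.le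
      gcongr
    · simp [hV, hAB]

end UnionBound

/-! ### From decoding errors to confusable supports -/

section Decoding

variable {N ℓ : ℕ}

/-- The set of active users of an activity vector. -/
def activeSet (x : Fin ℓ → Bool) : Finset (Fin ℓ) := Finset.univ.filter fun j => x j = true

lemma activeSet_injective : Function.Injective (activeSet (ℓ := ℓ)) := by
  intro x y h
  funext j
  have := Finset.ext_iff.1 h j
  simp only [activeSet, Finset.mem_filter, Finset.mem_univ, true_and] at this
  exact Bool.eq_iff_iff.2 this

lemma superpose_eq_sum (S : Fin N → Fin ℓ → ℝ) (x : Fin ℓ → Bool) (i : Fin N) :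
    superpose S x i = ∑ j ∈ activeSet x, S i j := by
  simp [superpose, toVec, activeSet, Finset.sum_filter]

lemma residual_received (S : Fin N → Fin ℓ → ℝ) (z : Fin N → ℝ) (x y : Fin ℓ → Bool) :
    residual S (received S x z) y =
      ∑ i, (z i + ∑ j ∈ activeSet x \ activeSet y, S i j -
        ∑ j ∈ activeSet y \ activeSet x, S i j) ^ 2 := by
  unfold residual received
  refine Finset.sum_congr rfl fun i _ => ?_
  rw [Pi.add_apply, superpose_eq_sum, superpose_eq_sum, add_sub_assoc (z i),
    Finset.sum_sdiff_sub_sum_sdiff]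
  ring

lemma IsLeastSquares.mem_confusable {r : ℝ} {S : Fin N → Fin ℓ → ℝ} {x y : Fin ℓ → Bool}
    {z : Fin N → ℝ} (h : IsLeastSquares r S (received S x z) y) (hx : (supportSize x : ℝ) ≤ r) :
    (S, z) ∈ confusable N (activeSet x) (activeSet y) := by
  have := h.2 x hx
  rw [residual_received, residual_received] at this
  simpa [confusable] using this

/-- Conditioning the error probability on the set of active users. -/
lemma errorProb_le {v d k : ℝ} {a : unitInterval} (hd0 : 0 < d) (hd1 : d ≤ 1) (hk : k = a * ℓ)
    {D : Decoder N ℓ} (hD : ∀ S y, IsLeastSquares ((1 + 2 * d) * k) S y (D S y)) (b : ENNReal)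
    (hb : ∀ T : Finset (Fin ℓ), (1 - d) * k ≤ T.card → (T.card : ℝ) ≤ (1 + d) * k →
      ((signatureLaw N ℓ v).prod (noiseLaw N)) {ω | ∃ U : Finset (Fin ℓ), U ≠ T ∧
        (U.card : ℝ) ≤ (1 + 2 * d) * k ∧ ω ∈ confusable N T U} ≤ b) :
    errorProb v a D ≤ 2 * ENNReal.ofReal (Real.exp (-(k * d ^ 2 / 4))) + b := by
  classical
  have hk0 : 0 ≤ k := by rw [hk]; exact mul_nonneg a.2.1 (Nat.cast_nonneg _)
  have : IsProbabilityMeasure (activityLaw ℓ a) := by unfold activityLaw; infer_instance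
  -- Moves the activity to the first factor, so that conditioning on its finitely many values
  -- becomes a finite union of rectangles.
  let e : (Fin N → Fin ℓ → ℝ) × ((Fin ℓ → Bool) × (Fin N → ℝ)) ≃ᵐ
      (Fin ℓ → Bool) × ((Fin N → Fin ℓ → ℝ) × (Fin N → ℝ)) :=
    MeasurableEquiv.prodAssoc.symm.trans
      ((MeasurableEquiv.prodComm.prodCongr (MeasurableEquiv.refl _)).trans
        MeasurableEquiv.prodAssoc)
  have he : MeasurePreserving e
      ((signatureLaw N ℓ v).prod ((activityLaw ℓ a).prod (noiseLaw N)))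
      ((activityLaw ℓ a).prod ((signatureLaw N ℓ v).prod (noiseLaw N))) :=
    (measurePreserving_prodAssoc _ _ _).comp
      ((Measure.measurePreserving_swap.prod (MeasurePreserving.id _)).comp
        (MeasurePreserving.symm _ (measurePreserving_prodAssoc _ _ _)))
  set E : Set (Fin ℓ → Bool) :=
    {x | (supportSize x : ℝ) < (1 - d) * k ∨ (1 + d) * k < supportSize x} with hE
  set F : (Fin ℓ → Bool) → Set ((Fin N → Fin ℓ → ℝ) × (Fin N → ℝ)) := fun x =>
    {ω | ∃ U : Finset (Fin ℓ), U ≠ activeSet x ∧ (U.card : ℝ) ≤ (1 + 2 * d) * k ∧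
      ω ∈ confusable N (activeSet x) U} with hF
  have hsub : {ω : (Fin N → Fin ℓ → ℝ) × ((Fin ℓ → Bool) × (Fin N → ℝ)) |
      D ω.1 (received ω.1 ω.2.1 ω.2.2) ≠ ω.2.1} ⊆
      e ⁻¹' (E ×ˢ Set.univ ∪ ⋃ x ∈ (Finset.univ : Finset (Fin ℓ → Bool)).filter (· ∉ E),
        {x} ×ˢ F x) := by
    rintro ⟨S, x, z⟩ hω
    by_cases hx : x ∈ E
    · exact Or.inl ⟨hx, trivial⟩
    · refine Or.inr (Set.mem_biUnion (x := x) (by simpa using hx) ⟨rfl, ?_⟩)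
      have hLS := hD S (received S x z)
      have hx2 : (supportSize x : ℝ) ≤ (1 + 2 * d) * k := by
        simp only [hE, Set.mem_ofPred_eq, not_or, not_lt] at hx
        nlinarith [hx.2]
      exact ⟨_, fun h => hω (activeSet_injective h), hLS.1, hLS.mem_confusable hx2⟩
  -- No measurability of the decoder is needed: monotonicity holds for all sets, and a
  -- measure-preserving equivalence preserves the measure of all preimages.
  calc errorProb v a D ≤ _ := measure_mono hsub
    _ = ((activityLaw ℓ a).prod ((signatureLaw N ℓ v).prod (noiseLaw N))) (E ×ˢ Set.univ ∪
        ⋃ x ∈ (Finset.univ : Finset (Fin ℓ → Bool)).filter (· ∉ E), {x} ×ˢ F x) :=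
      he.measure_preimage_equiv _
    _ ≤ _ := (measure_union_le _ _).trans (add_le_add ?_ ?_)
  · rw [Measure.prod_prod, measure_univ, mul_one]
    exact activity_concentration a hd0 hd1 hk
  · refine (measure_biUnion_finset_le _ _).trans ?_
    calc _ ≤ ∑ x ∈ (Finset.univ : Finset (Fin ℓ → Bool)).filter (· ∉ E),
          activityLaw ℓ a {x} * b := by
          refine Finset.sum_le_sum fun x hx => ?_
          rw [Measure.prod_prod]
          have hx' : x ∉ E := (Finset.mem_filter.1 hx).2
          simp only [hE, Set.mem_ofPred_eq, not_or, not_lt] at hx'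
          gcongr
          exact hb _ hx'.1 hx'.2
      _ = activityLaw ℓ a ((Finset.univ : Finset (Fin ℓ → Bool)).filter (· ∉ E)) * b := by
          rw [← Finset.sum_mul, sum_measure_singleton]
      _ ≤ 1 * b := by gcongr; exact prob_le_one
      _ = b := one_mul b

/-- Error probability in terms of the Hamming distance and of the number of missed users. -/
lemma errorProb_le_exp {v k d ζ η t C L Q : ℝ} {a : unitInterval} (hv : 0 < v)
    (hk : k = a * ℓ) (hk0 : 0 < k) (hζ0 : 0 < ζ) (hζ1 : ζ ≤ 1) (hη0 : 0 < η) (hη1 : η ≤ 1 / 2)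
    (ht0 : 0 < t) (ht1 : t < 1) (hd0 : 0 < d) (hd : 8 * d ≤ η) (hkN : k ≤ C * N)
    (hent : k * Real.log (a : ℝ)⁻¹ ≤ N / 2 * L)
    (hL : 4 * ζ * L ≤ Real.log (1 + ζ * k * v / 4))
    (hζC : 8 * C * √ζ ≤ Real.log (1 + v / 4) / 4)
    (hQ : ((((Finset.univ : Finset (Finset (Fin ℓ))).filter
      fun B => (B.card : ℝ) ≤ (1 + 2 * d) * k).card : ℕ) : ℝ) ≤ Real.exp Q)
    {D : Decoder N ℓ} (hD : ∀ S y, IsLeastSquares ((1 + 2 * d) * k) S y (D S y)) :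
    errorProb v a D ≤ 2 * ENNReal.ofReal (Real.exp (-(k * d ^ 2 / 4))) +
      (ENNReal.ofReal (Real.exp (Real.log k - N / 4 * Real.log (1 + v / 4))) +
      (ENNReal.ofReal (Real.exp ((1 - η / 2) * (k * Real.log (a : ℝ)⁻¹) + 3 * k -
        N / 2 * Real.log (1 + ζ * k * v / 4))) +
      (ENNReal.ofReal (Real.exp (-(N * (t ^ 2 / 16)))) +
        (ENNReal.ofReal (Real.exp (4 * √η * k + -(N * (t ^ 2 / 4)))) +
          ENNReal.ofReal (Real.exp (4 * √η * k + (Q +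
            -(N / 2 * (Real.log (1 + (1 - 2 * η) * k * v) + Real.log (1 - t) - t)))))))) ) := by
  have ha0 : (0 : ℝ) < a := by
    rcases a.2.1.lt_or_eq with h | h
    · exact h
    · rw [hk, ← h] at hk0; simp at hk0
  refine errorProb_le hd0 (by linarith) hk hD _ fun T hT1 hT2 => ?_
  have hT3 : (T.card : ℝ) ≤ 2 * k := by nlinarith
  refine (measure_mono ?_).trans ((measure_union_le _ _).trans (add_le_add
    (measure_near_le (C := C) (L := L) hv ha0 a.2.2 hk hk0 hT3 hζ0 hζ1 hkN hent hL hζC)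
      ((measure_union_le _ _).trans (add_le_add
        (measure_far_le hv ha0 a.2.2 hk hk0 hζ0 hη0 (by linarith) hd0 hd hT1 hT2)
        (measure_missing_le hv hη0 hη1 ht0 ht1 hd0 (by linarith) hk0 hT1 hT3 hQ)))))
  rintro ω ⟨U, h1, h2, h3⟩
  rcases le_total ((T \ U).card + (U \ T).card : ℝ) (ζ * k) with h4 | h4
  · exact Or.inl ⟨U, h1, h4, h3⟩
  rcases le_total ((T \ U).card : ℝ) ((1 - η) * T.card) with h5 | h5
  · exact Or.inr (Or.inl ⟨U, h4, h5, h2, h3⟩)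
  · exact Or.inr (Or.inr ⟨U, h5, h2, h3⟩)

end Decoding

/-! ### Asymptotic estimates -/

section Limits

lemma tendsto_ofReal_exp_zero {f : ℕ → ℝ} (hf : Tendsto f atTop atBot) :
    Tendsto (fun n => ENNReal.ofReal (Real.exp (f n))) atTop (𝓝 0) := by
  simpa using ENNReal.tendsto_ofReal (Real.tendsto_exp_atBot.comp hf)

lemma tendsto_ofReal_exp_zero_of_le {f : ℕ → ℝ} {N : ℕ → ℝ} (hN : Tendsto N atTop atTop) {κ : ℝ}
    (hκ : 0 < κ) (h : ∀ᶠ n in atTop, f n ≤ -(κ * N n)) :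
    Tendsto (fun n => ENNReal.ofReal (Real.exp (f n))) atTop (𝓝 0) :=
  tendsto_ofReal_exp_zero (tendsto_atBot_mono' _ h
    (tendsto_neg_atTop_atBot.comp (hN.const_mul_atTop hκ)))

/-- As `1 + xp ≤ (p/q)(1 + xq)`, scaling the power down costs only an additive constant in the
logarithm. -/
lemma log_one_add_mul_le {x p q : ℝ} (hx : 0 ≤ x) (hq : 0 < q) (hqp : q ≤ p) :
    Real.log (1 + x * p) ≤ Real.log (1 + x * q) + Real.log (p / q) := by
  have hp : 0 < p := hq.trans_le hqp
  rw [← Real.log_mul (by positivity) (by positivity)]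
  refine Real.log_le_log (by positivity) ?_
  have : 1 ≤ p / q := (one_le_div hq).2 hqp
  have e : x * q * (p / q) = x * p := by field_simp
  nlinarith

variable {P : ℝ} {k N : ℕ → ℝ}

lemma tendsto_log_one_add_mul (hP : 0 < P) (hk : Tendsto k atTop atTop) :
    Tendsto (fun n => Real.log (1 + k n * P)) atTop atTop :=
  Real.tendsto_log_atTop.comp (tendsto_atTop_add_const_left _ _ (hk.atTop_mul_const hP))

lemma eventually_log_one_add_mul_le {C : ℝ} (hP : 0 < P) (hk : Tendsto k atTop atTop)
    (hC : 0 < C) (hkN : ∀ᶠ n in atTop, k n ≤ C * N n) {κ : ℝ} (hκ : 0 < κ) :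
    ∀ᶠ n in atTop, Real.log (1 + k n * P) ≤ κ * N n := by
  have ht : Tendsto (fun n => 1 + k n * P) atTop atTop :=
    tendsto_atTop_add_const_left _ _ (hk.atTop_mul_const hP)
  have h1 := ht.eventually (Real.isLittleO_log_id_atTop.bound
    (show (0 : ℝ) < κ / (2 * P * C) by positivity))
  filter_upwards [h1, hkN, hk.eventually_ge_atTop (1 / P), hk.eventually_ge_atTop 0]
    with n h1 h2 h3 h4
  have h5 : 1 ≤ k n * P := by rwa [div_le_iff₀ hP] at h3
  rw [id, Real.norm_eq_abs, Real.norm_eq_abs, abs_of_pos (show 0 < 1 + k n * P by positivity)] at h1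
  calc Real.log (1 + k n * P) ≤ κ / (2 * P * C) * (1 + k n * P) := (le_abs_self _).trans h1
    _ ≤ κ / (2 * P * C) * (2 * P * (C * N n)) := by
      gcongr
      nlinarith
    _ = κ * N n := by field_simp

/-- Since `log k → ∞`, already `d log k → 0` forces `d → 0`; and `log (1 + kP) ≤ log k + log (1 +
P)` once `k ≥ 1`. -/
lemma tendsto_mul_log_one_add_mul {d : ℕ → ℝ} (hP : 0 < P) (hk : Tendsto k atTop atTop)
    (hd0 : ∀ n, 0 < d n) (hd : Tendsto (fun n => d n * Real.log (k n)) atTop (𝓝 0)) :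
    Tendsto d atTop (𝓝 0) ∧ Tendsto (fun n => d n * Real.log (1 + k n * P)) atTop (𝓝 0) := by
  have hlog : Tendsto (fun n => Real.log (k n)) atTop atTop := Real.tendsto_log_atTop.comp hk
  have h1 : Tendsto d atTop (𝓝 0) := by
    refine tendsto_of_tendsto_of_tendsto_of_le_of_le' tendsto_const_nhds hd
      (Eventually.of_forall fun n => (hd0 n).le) ?_
    filter_upwards [hlog.eventually_ge_atTop 1] with n hn
    nlinarith [hd0 n]
  refine ⟨h1, ?_⟩
  have h2 : Tendsto (fun n => d n * Real.log (k n) + d n * Real.log (1 + P)) atTop (𝓝 0) := by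
    simpa using hd.add (h1.mul_const (Real.log (1 + P)))
  refine tendsto_of_tendsto_of_tendsto_of_le_of_le' tendsto_const_nhds h2 ?_ ?_
  · filter_upwards [hk.eventually_ge_atTop 0] with n hn
    exact mul_nonneg (hd0 n).le (Real.log_nonneg (by nlinarith))
  · filter_upwards [hk.eventually_ge_atTop 1] with n hn
    rw [← mul_add, ← Real.log_mul (by positivity) (by positivity)]
    refine mul_le_mul_of_nonneg_left (Real.log_le_log (by positivity) ?_) (hd0 n).le
    nlinarith

end Limits

/-! ### Vanishing error probability under a linear entropy margin -/

section Achievability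

open Real

lemma mul_log_inv_le_binEntropy {a : ℝ} (ha0 : 0 ≤ a) (ha1 : a ≤ 1) :
    a * log a⁻¹ ≤ binEntropy a := by
  have h : 0 ≤ log (1 - a)⁻¹ := by
    rcases ha1.lt_or_eq with h | h
    · exact log_nonneg ((one_le_inv₀ (by linarith)).2 (by linarith))
    · simp [h]
  rw [binEntropy]
  nlinarith [mul_nonneg (sub_nonneg.2 ha1) h]

/-- Number of supports of admissible size, for large average activity. -/
lemma card_admissible_le {ℓ : ℕ} {a k d C c L N : ℝ} (ha0 : 0 < a) (ha1 : a ≤ 1) (hk : k = a * ℓ)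
    (hk0 : 0 < k) (hd0 : 0 < d) (hd1 : d ≤ 1) (hkN : k ≤ C * N) (hN : 0 ≤ N) (hL0 : 0 ≤ L)
    (hcap : ℓ * binEntropy a + c * N ≤ N / 2 * L) (hc : 0 ≤ c) (hL : 8 * C + 2 * c ≤ L) :
    ((((Finset.univ : Finset (Finset (Fin ℓ))).filter
      fun B => (B.card : ℝ) ≤ (1 + 2 * d) * k).card : ℕ) : ℝ) ≤
        exp (N / 2 * L - c * N + d * L * N) := by
  have hent : k * log a⁻¹ ≤ ℓ * binEntropy a := by
    rw [hk, mul_comm a, mul_assoc]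
    exact mul_le_mul_of_nonneg_left (mul_log_inv_le_binEntropy ha0.le ha1) (Nat.cast_nonneg _)
  -- For `a ≥ 1/2` the entropy need not bound the count. There `log (1/a) ≤ 1`, so the exponent is
  -- at most `4k ≤ 4CN`, which is negligible against `(N/2) L` once `L` is large.
  rcases le_total a (1 / 2) with ha | ha
  · refine (card_le_exp_binEntropy Finset.univ _ (m := (1 + 2 * d) * k) ha0 ha
      (by simp +contextual) (by simp only [Finset.card_univ, Fintype.card_fin, ← hk]; nlinarith)).trans
      (exp_le_exp.2 ?_)
    rw [Finset.card_univ, Fintype.card_fin, ← hk]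
    have : 2 * d * (k * log a⁻¹) ≤ 2 * d * (N / 2 * L) :=
      mul_le_mul_of_nonneg_left (by nlinarith) (by positivity)
    nlinarith
  · refine (card_le_exp_log_inv Finset.univ _ (m := (1 + 2 * d) * k) ha0 ha1
      (by simp +contextual)).trans (exp_le_exp.2 ?_)
    rw [Finset.card_univ, Fintype.card_fin, ← hk]
    have h1 : log a⁻¹ ≤ 1 := by
      have h2 : a⁻¹ ≤ 2 := by rw [inv_le_comm₀ ha0 two_pos]; linarith
      linarith [log_le_sub_one_of_pos (inv_pos.2 ha0)]
    have h3 : (1 + 2 * d) * k * log a⁻¹ ≤ (1 + 2 * d) * k * 1 :=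
      mul_le_mul_of_nonneg_left h1 (by positivity)
    have h4 : d * k ≤ k := by nlinarith
    have h5 : N / 2 * (8 * C + 2 * c) ≤ N / 2 * L := by gcongr
    have h6 : 0 ≤ d * L * N := by positivity
    nlinarith

/-- Least squares decoding succeeds whenever the number of samples exceeds the entropy of the
activity by a linear margin. -/
theorem tendsto_errorProb_zero {P v c C : ℝ} (hP : 0 < P) (hv : 0 < v) (hvP : v ≤ P) (hc : 0 < c)
    (hC : 0 < C) (hPv : log (P / v) ≤ c / 2) {ℓ N : ℕ → ℕ} {α : ℕ → unitInterval} {d : ℕ → ℝ}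
    (hk : Tendsto (avgActive ℓ α) atTop atTop) (hkN : ∀ᶠ n in atTop, avgActive ℓ α n ≤ C * N n)
    (hcap : ∀ᶠ n in atTop, (ℓ n : ℝ) * binEntropy (α n) + c * N n ≤
      N n / 2 * log (1 + avgActive ℓ α n * P))
    (hd0 : ∀ n, 0 < d n) (hdk : Tendsto (fun n => d n ^ 2 * avgActive ℓ α n) atTop atTop)
    (hdl : Tendsto (fun n => d n * log (avgActive ℓ α n)) atTop (𝓝 0))
    {D : (n : ℕ) → Decoder (N n) (ℓ n)}
    (hD : ∀ n S y, IsLeastSquares ((1 + 2 * d n) * avgActive ℓ α n) S y (D n S y)) :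
    Tendsto (fun n => errorProb v (α n) (D n)) atTop (𝓝 0) := by
  -- The constants are chosen in the order `t`, `η`, then `ζ`. Here `t` is small against the margin
  -- `c`; `η` is small against `c`, and so small that the `exp (4 √η k)` choices of `T \ U` do not
  -- spoil norm tails of order `exp (-t² N / 4)`.
  obtain ⟨t, ht0, ht2, htc⟩ : ∃ t : ℝ, 0 < t ∧ t ≤ 1 / 2 ∧ t ≤ c / 16 :=
    ⟨min (1 / 2) (c / 16), by positivity, min_le_left _ _, min_le_right _ _⟩
  obtain ⟨η, hη0, hη1, hηc, hηC⟩ : ∃ η : ℝ, 0 < η ∧ η ≤ 1 / 4 ∧ η ≤ c / 32 ∧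
      4 * √η * C ≤ t ^ 2 / 8 := by
    refine ⟨min (min (1 / 4) (c / 32)) ((t ^ 2 / (32 * C)) ^ 2), by positivity,
      (min_le_left _ _).trans (min_le_left _ _), (min_le_left _ _).trans (min_le_right _ _), ?_⟩
    have h := sqrt_le_sqrt (min_le_right (min (1 / 4) (c / 32)) ((t ^ 2 / (32 * C)) ^ 2))
    rw [sqrt_sq (by positivity)] at h
    calc _ ≤ 4 * (t ^ 2 / (32 * C)) * C := by gcongr
      _ = t ^ 2 / 8 := by field_simp; norm_num
  have hv4 : 0 < log (1 + v / 4) := log_pos (by linarith)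
  -- With `ζ ≤ 1/16` one has `4ζL ≤ L/4`, below `L - R` for large `L`; the second bound makes the
  -- term `4 √(wk)` harmless at near distances.
  obtain ⟨ζ, hζ0, hζ1, hζC⟩ : ∃ ζ : ℝ, 0 < ζ ∧ ζ ≤ 1 / 16 ∧
      8 * C * √ζ ≤ log (1 + v / 4) / 4 := by
    refine ⟨min (1 / 16) ((log (1 + v / 4) / (32 * C)) ^ 2), by positivity, min_le_left _ _, ?_⟩
    have h := sqrt_le_sqrt (min_le_right (1 / 16) ((log (1 + v / 4) / (32 * C)) ^ 2))
    rw [sqrt_sq (by positivity)] at h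
    calc _ ≤ 8 * C * (log (1 + v / 4) / (32 * C)) := by gcongr
      _ = log (1 + v / 4) / 4 := by field_simp; ring
  set L : ℕ → ℝ := fun n => log (1 + avgActive ℓ α n * P) with hLdef
  have hL : Tendsto L atTop atTop := tendsto_log_one_add_mul hP hk
  obtain ⟨hd, hdL⟩ := tendsto_mul_log_one_add_mul hP hk hd0 hdl
  have hN : Tendsto (fun n => (N n : ℝ)) atTop atTop := by
    refine tendsto_atTop_mono' _ ?_ (hk.atTop_div_const hC)
    filter_upwards [hkN] with n hn
    rw [div_le_iff₀ hC]
    linarith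
  set R : ℝ := log (P / (ζ * v / 4)) with hR
  have hLR : ∀ᶠ n in atTop, L n ≤ log (1 + ζ * avgActive ℓ α n * v / 4) + R := by
    filter_upwards [hk.eventually_ge_atTop 0] with n hn
    have := log_one_add_mul_le (p := P) (q := ζ * v / 4) hn (by positivity) (by nlinarith)
    rwa [show avgActive ℓ α n * (ζ * v / 4) = ζ * avgActive ℓ α n * v / 4 by ring] at this
  have hent : ∀ᶠ n in atTop, avgActive ℓ α n * log (α n : ℝ)⁻¹ ≤ N n / 2 * L n := by
    filter_upwards [hcap] with n h1
    have h2 := mul_le_mul_of_nonneg_left (mul_log_inv_le_binEntropy (α n).2.1 (α n).2.2)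
      (Nat.cast_nonneg (α := ℝ) (ℓ n))
    have h3 : 0 ≤ c * N n := by positivity
    have h4 : avgActive ℓ α n * log (α n : ℝ)⁻¹ = ℓ n * (α n * log (α n : ℝ)⁻¹) := by
      rw [avgActive]; ring
    linarith
  have hbound : ∀ᶠ n in atTop, errorProb v (α n) (D n) ≤
      2 * ENNReal.ofReal (exp (-(avgActive ℓ α n * d n ^ 2 / 4))) +
      (ENNReal.ofReal (exp (log (avgActive ℓ α n) - N n / 4 * log (1 + v / 4))) +
      (ENNReal.ofReal (exp ((1 - η / 2) * (avgActive ℓ α n * log (α n : ℝ)⁻¹) +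
        3 * avgActive ℓ α n - N n / 2 * log (1 + ζ * avgActive ℓ α n * v / 4))) +
      (ENNReal.ofReal (exp (-(N n * (t ^ 2 / 16)))) +
        (ENNReal.ofReal (exp (4 * √η * avgActive ℓ α n + -(N n * (t ^ 2 / 4)))) +
          ENNReal.ofReal (exp (4 * √η * avgActive ℓ α n + ((N n / 2 * L n - c * N n +
            d n * L n * N n) + -(N n / 2 * (log (1 + (1 - 2 * η) * avgActive ℓ α n * v) +
              log (1 - t) - t)))))))) ) := by
    filter_upwards [hkN, hcap, hk.eventually_gt_atTop 0, hLR, hL.eventually_ge_atTop (2 * R),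
      hL.eventually_ge_atTop (8 * C + 2 * c), hd.eventually_le_const (by positivity : 0 < η / 8), hent]
      with n h1 h2 h3 h4 h5 h6 h7 hent
    have hL0 : 0 ≤ L n := (by positivity : 0 ≤ 8 * C + 2 * c).trans h6
    have ha0 : (0 : ℝ) < α n := by
      rcases (α n).2.1.lt_or_eq with h | h
      · exact h
      · rw [avgActive, ← h] at h3; simp at h3
    have h8 : 4 * ζ * L n ≤ log (1 + ζ * avgActive ℓ α n * v / 4) := by
      have : 4 * ζ * L n ≤ 1 / 4 * L n := mul_le_mul_of_nonneg_right (by linarith) hL0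
      linarith
    exact errorProb_le_exp (C := C) (L := L n) hv rfl h3 hζ0 (by linarith) hη0 (by linarith) ht0
      (by linarith) (hd0 n) (by linarith) h1 hent h8 hζC
      (card_admissible_le ha0 (α n).2.2 rfl h3 (hd0 n) (by linarith) h1 (Nat.cast_nonneg _) hL0 h2
        hc.le h6) (hD n)
  refine tendsto_of_tendsto_of_tendsto_of_le_of_le' tendsto_const_nhds ?_
    (Eventually.of_forall fun _ => zero_le) hbound
  have T1 : Tendsto (fun n => ENNReal.ofReal (exp (-(avgActive ℓ α n * d n ^ 2 / 4)))) atTop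
      (𝓝 0) := by
    refine tendsto_ofReal_exp_zero_of_le hdk (κ := 1 / 4) (by norm_num)
      (Eventually.of_forall fun n => le_of_eq (by ring))
  have T2 : Tendsto (fun n => ENNReal.ofReal (exp (log (avgActive ℓ α n) -
      N n / 4 * log (1 + v / 4)))) atTop (𝓝 0) := by
    refine tendsto_ofReal_exp_zero_of_le hN (κ := log (1 + v / 4) / 8) (by positivity) ?_
    filter_upwards [eventually_log_one_add_mul_le one_pos hk hC hkN
      (by positivity : 0 < log (1 + v / 4) / 8), hk.eventually_gt_atTop 0] with n h1 h2
    have h3 : log (avgActive ℓ α n) ≤ log (1 + avgActive ℓ α n * 1) :=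
      log_le_log h2 (by linarith)
    linarith
  have T3 : Tendsto (fun n => ENNReal.ofReal (exp ((1 - η / 2) *
      (avgActive ℓ α n * log (α n : ℝ)⁻¹) + 3 * avgActive ℓ α n -
        N n / 2 * log (1 + ζ * avgActive ℓ α n * v / 4)))) atTop (𝓝 0) := by
    refine tendsto_ofReal_exp_zero_of_le hN (κ := 1) one_pos ?_
    -- The saving `(η/4) L N` has an unbounded coefficient, so it beats the linear losses `3k ≤ 3CN`
    -- and `(R/2) N`.
    filter_upwards [hkN, hcap, hLR, hL.eventually_ge_atTop (4 / η * (3 * C + R / 2 + 1)),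
      hk.eventually_ge_atTop 0, hent] with n h1 h2 h3 h4 h5 hent
    have hN0 : (0 : ℝ) ≤ N n := Nat.cast_nonneg _
    have h6 : (1 - η / 2) * (avgActive ℓ α n * log (α n : ℝ)⁻¹) ≤ (1 - η / 2) * (N n / 2 * L n) :=
      mul_le_mul_of_nonneg_left hent (by linarith)
    have h7 : (N n : ℝ) / 2 * L n ≤
        N n / 2 * (log (1 + ζ * avgActive ℓ α n * v / 4) + R) := by gcongr
    have h8 : 3 * C + R / 2 + 1 ≤ η / 4 * L n := by
      have := mul_le_mul_of_nonneg_left h4 (by positivity : 0 ≤ η / 4)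
      rwa [← mul_assoc, show η / 4 * (4 / η) = 1 by field_simp, one_mul] at this
    have h9 := mul_le_mul_of_nonneg_left h8 hN0
    linarith
  have T4 : Tendsto (fun n => ENNReal.ofReal (exp (-(N n * (t ^ 2 / 16))))) atTop (𝓝 0) :=
    tendsto_ofReal_exp_zero_of_le hN (κ := t ^ 2 / 16) (by positivity)
      (Eventually.of_forall fun n => le_of_eq (by ring))
  have T5 : Tendsto (fun n => ENNReal.ofReal (exp (4 * √η * avgActive ℓ α n +
      -(N n * (t ^ 2 / 4))))) atTop (𝓝 0) := by
    refine tendsto_ofReal_exp_zero_of_le hN (κ := t ^ 2 / 8) (by positivity) ?_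
    filter_upwards [hkN] with n h1
    have h2 : 4 * √η * avgActive ℓ α n ≤ 4 * √η * (C * N n) := by gcongr
    have h3 := mul_le_mul_of_nonneg_right hηC (Nat.cast_nonneg (α := ℝ) (N n))
    linarith
  have T6 : Tendsto (fun n => ENNReal.ofReal (exp (4 * √η * avgActive ℓ α n +
      ((N n / 2 * L n - c * N n + d n * L n * N n) +
        -(N n / 2 * (log (1 + (1 - 2 * η) * avgActive ℓ α n * v) + log (1 - t) - t))))))
      atTop (𝓝 0) := by
    refine tendsto_ofReal_exp_zero_of_le hN (κ := c / 4) (by positivity) ?_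
    filter_upwards [hkN, hk.eventually_ge_atTop 0,
      hdL.eventually_le_const (by positivity : 0 < c / 8)] with n h1 h0 h5
    have hN0 := Nat.cast_nonneg (α := ℝ) (N n)
    have h2 : 4 * √η * avgActive ℓ α n ≤ 4 * √η * (C * N n) := by gcongr
    have h3 := mul_le_mul_of_nonneg_right hηC hN0
    have hη2 : 0 < 1 - 2 * η := by linarith
    have h6 := log_one_add_mul_le (p := P) (q := (1 - 2 * η) * v) h0 (by positivity) (by nlinarith)
    rw [show avgActive ℓ α n * ((1 - 2 * η) * v) = (1 - 2 * η) * avgActive ℓ α n * v by ring,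
      show P / ((1 - 2 * η) * v) = P / v * (1 - 2 * η)⁻¹ by field_simp,
      log_mul (by positivity) (by positivity)] at h6
    have h7 : log (1 - 2 * η)⁻¹ ≤ 4 * η := by
      refine (log_le_sub_one_of_pos (by positivity)).trans ?_
      have : (1 - 2 * η)⁻¹ ≤ 1 + 4 * η := by
        rw [inv_le_iff_one_le_mul₀ hη2]
        nlinarith
      linarith
    have h8 : -(2 * t) ≤ log (1 - t) := by
      have h9 : 0 < 1 - t := by linarith
      refine le_trans ?_ (one_sub_inv_le_log_of_pos h9)
      have : (1 - t)⁻¹ ≤ 1 + 2 * t := by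
        rw [inv_le_iff_one_le_mul₀ h9]
        nlinarith
      linarith
    -- The losses are `c/2` from the power back-off, `4η` from missing only nearly all users and
    -- `3t` from the typical norms. After multiplication by `N/2`, and with `(c/8) N` for the excess
    -- size, they stay below the margin `c N`.
    have h10 : L n - (log (1 + (1 - 2 * η) * avgActive ℓ α n * v) + log (1 - t) - t) ≤
        c / 2 + 4 * η + 3 * t := by linarith
    have h11 := mul_le_mul_of_nonneg_left h10 (by positivity : (0 : ℝ) ≤ N n / 2)
    have h12 := mul_le_mul_of_nonneg_right h5 hN0
    have h13 : t ^ 2 / 8 ≤ t / 8 := by nlinarith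
    have h14 := mul_le_mul_of_nonneg_right h13 hN0
    have h15 := mul_le_mul_of_nonneg_right htc hN0
    have h16 := mul_le_mul_of_nonneg_right hηc hN0
    have h17 : 0 ≤ c * N n := by positivity
    linarith
  have T1' := ENNReal.Tendsto.const_mul T1 (Or.inr (by norm_num : (2 : ENNReal) ≠ ⊤))
  rw [mul_zero] at T1'
  simpa using T1'.add (T2.add (T3.add (T4.add (T5.add T6))))

end Achievability

/-! ### The entropy margin provided by the signature length -/

section SignatureLength

open Real

variable {P ε : ℝ} {ℓ N : ℕ → ℕ} {α : ℕ → unitInterval}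

/-- If `θ_n → 0`, a number `ε n` of samples exceeds the entropy by a linear margin. -/
lemma margin_of_tendsto_theta (hP : 0 < P) (hε : 0 < ε)
    (hk : Tendsto (avgActive ℓ α) atTop atTop)
    (hkO : avgActive ℓ α =O[atTop] (fun n : ℕ => (n : ℝ)))
    (hθ : Tendsto (theta P ℓ α) atTop (𝓝 0)) (hN : ∀ n, |(N n : ℝ) - ε * n| < 1) (c : ℝ) :
    (∃ C, 0 < C ∧ ∀ᶠ n in atTop, avgActive ℓ α n ≤ C * N n) ∧
      ∀ᶠ n in atTop, (ℓ n : ℝ) * binEntropy (α n) + c * N n ≤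
        N n / 2 * log (1 + avgActive ℓ α n * P) := by
  obtain ⟨C₁, hC₁, hO⟩ := hkO.exists_pos
  have hnat : Tendsto (fun n : ℕ => (n : ℝ)) atTop atTop := tendsto_natCast_atTop_atTop
  have hn : ∀ᶠ n : ℕ in atTop, (n : ℝ) ≤ 2 / ε * N n ∧ (0 : ℝ) < n := by
    filter_upwards [hnat.eventually_ge_atTop (2 / ε), hnat.eventually_gt_atTop 0] with n h1 h0
    refine ⟨?_, h0⟩
    have h2 := abs_lt.1 (hN n)
    rw [div_le_iff₀ hε] at h1
    rw [div_mul_eq_mul_div, le_div_iff₀ hε]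
    linarith
  refine ⟨⟨C₁ * (2 / ε), by positivity, ?_⟩, ?_⟩
  · filter_upwards [hO.bound, hn] with n h1 h2
    rw [norm_eq_abs, norm_eq_abs, Nat.abs_cast] at h1
    calc avgActive ℓ α n ≤ C₁ * n := (le_abs_self _).trans h1
      _ ≤ C₁ * (2 / ε * N n) := by have := h2.1; gcongr
      _ = _ := by ring
  -- With `θ ≤ ε/4` and `n ≤ (2/ε) N`, the entropy `θ n L / 2` is at most `N L / 4`. The other `N L
  -- / 4` exceeds `c N` when `L ≥ 4c`, so any `c` is possible.
  · filter_upwards [hn, hθ.eventually_le_const (by positivity : 0 < ε / 4),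
      (tendsto_log_one_add_mul hP hk).eventually_ge_atTop (4 * c),
      (tendsto_log_one_add_mul hP hk).eventually_gt_atTop 0] with n h1 h2 h3 h4
    have h5 : (n : ℝ) * log (1 + avgActive ℓ α n * P) ≤
        2 / ε * N n * log (1 + avgActive ℓ α n * P) := by have := h1.1; gcongr
    rw [theta, div_le_iff₀ (mul_pos h1.2 h4)] at h2
    have h6 := mul_le_mul_of_nonneg_left h5 (by positivity : 0 ≤ ε / 4)
    rw [show ε / 4 * (2 / ε * N n * log (1 + avgActive ℓ α n * P)) =
      N n / 2 * log (1 + avgActive ℓ α n * P) by field_simp; norm_num] at h6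
    have h7 := mul_le_mul_of_nonneg_left h3 (Nat.cast_nonneg (α := ℝ) (N n))
    linarith

/-- If `θ_n` stays away from `0`, the signature length exceeds the entropy by a linear margin. -/
lemma margin_of_le_theta (hP : 0 < P) (hε : 0 < ε)
    (hk : Tendsto (avgActive ℓ α) atTop atTop)
    (hkO : avgActive ℓ α =O[atTop] (fun n : ℕ => (n : ℝ))) {c : ℝ} (hc : 0 < c)
    (hθ : ∀ᶠ n in atTop, c ≤ theta P ℓ α n)
    (hN : ∀ n, |(N n : ℝ) - (1 + ε / log (1 + avgActive ℓ α n * P)) * theta P ℓ α n * n| < 1) :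
    (∃ C, 0 < C ∧ ∀ᶠ n in atTop, avgActive ℓ α n ≤ C * N n) ∧
      ∀ᶠ n in atTop, (ℓ n : ℝ) * binEntropy (α n) + ε / 8 * N n ≤
        N n / 2 * log (1 + avgActive ℓ α n * P) := by
  obtain ⟨C₁, hC₁, hO⟩ := hkO.exists_pos
  have hL := tendsto_log_one_add_mul hP hk
  have hnat : Tendsto (fun n : ℕ => (n : ℝ)) atTop atTop := tendsto_natCast_atTop_atTop
  have hn : ∀ᶠ n : ℕ in atTop, (n : ℝ) ≤ 2 / c * N n ∧ (0 : ℝ) < n := by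
    filter_upwards [hnat.eventually_ge_atTop (2 / c), hnat.eventually_gt_atTop 0, hθ,
      hL.eventually_gt_atTop 0] with n h1 h0 h3 h4
    refine ⟨?_, h0⟩
    have h2 := abs_lt.1 (hN n)
    rw [div_le_iff₀ hc] at h1
    rw [div_mul_eq_mul_div, le_div_iff₀ hc]
    have h5 : c * n ≤ theta P ℓ α n * n := by gcongr
    have h6 : 0 ≤ ε / log (1 + avgActive ℓ α n * P) * (theta P ℓ α n * n) := by
      have : 0 < theta P ℓ α n := hc.trans_le h3
      positivity
    linarith
  have hkN : ∀ᶠ n in atTop, avgActive ℓ α n ≤ C₁ * (2 / c) * N n := by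
    filter_upwards [hO.bound, hn] with n h1 h2
    rw [norm_eq_abs, norm_eq_abs, Nat.abs_cast] at h1
    calc avgActive ℓ α n ≤ C₁ * n := (le_abs_self _).trans h1
      _ ≤ C₁ * (2 / c * N n) := by have := h2.1; gcongr
      _ = _ := by ring
  refine ⟨⟨C₁ * (2 / c), by positivity, hkN⟩, ?_⟩
  have hNt : Tendsto (fun n => (N n : ℝ)) atTop atTop := by
    refine tendsto_atTop_mono' _ ?_ (hk.atTop_div_const (by positivity : 0 < C₁ * (2 / c)))
    filter_upwards [hkN] with n hn
    rw [div_le_iff₀ (by positivity)]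
    linarith
  filter_upwards [hn, hL.eventually_ge_atTop ε, eventually_log_one_add_mul_le hP hk
    (by positivity : 0 < C₁ * (2 / c)) hkN (by positivity : 0 < ε / 8),
    hNt.eventually_ge_atTop 4] with n h1 h2 h3 h4
  have h5 := abs_lt.1 (hN n)
  set L := log (1 + avgActive ℓ α n * P) with hLdef
  have hL0 : 0 < L := hε.trans_le h2
  set H := (ℓ n : ℝ) * binEntropy (α n) with hH
  have hH0 : 0 ≤ H := mul_nonneg (Nat.cast_nonneg _) (binEntropy_nonneg (α n).2.1 (α n).2.2)
  have e : (1 + ε / L) * theta P ℓ α n * n = (1 + ε / L) * (2 * (H / L)) := by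
    have := h1.2
    rw [theta, ← hLdef, hH]
    field_simp
  rw [e] at h5
  have h6 : ε / L ≤ 1 := (div_le_one hL0).2 h2
  have h7 : 0 ≤ H / L := by positivity
  have h8 : (1 + ε / L) * (2 * (H / L)) ≤ 4 * (H / L) := by nlinarith
  have h9 : (N n - 1 : ℝ) / 4 ≤ H / L := by linarith
  -- Multiplying the length by `L/2` gives `H + ε H/L`, with `ε H/L ≥ ε (N-1)/4 ≥ 3εN/16` for `N ≥
  -- 4`. Rounding costs `L/2 ≤ εN/16`, so `εN/8` remains.
  have h10 := mul_le_mul_of_nonneg_left h5.1.le (by positivity : 0 ≤ L / 2)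
  have h11 : L / 2 * ((1 + ε / L) * (2 * (H / L))) = H + ε * (H / L) := by field_simp
  have h12 := mul_le_mul_of_nonneg_left h9 hε.le
  have h13 := mul_le_mul_of_nonneg_left h4 hε.le
  linarith

end SignatureLength

end ManyAccess

theorem theorem2 (P ε : ℝ) (hP : 0 < P) (hε : 0 < ε) :
    ∃ δ₀ : ℝ, 0 < δ₀ ∧ δ₀ ≤ P ∧ ∀ δ : ℝ, 0 < δ → δ < δ₀ →
      ∀ (ℓ : ℕ → ℕ) (α : ℕ → unitInterval) (d : ℕ → ℝ),
        Tendsto (ManyAccess.avgActive ℓ α) atTop atTop →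
        ManyAccess.avgActive ℓ α =O[atTop] (fun n : ℕ => (n : ℝ)) →
        (∀ c : ℝ, 0 < c →
          Tendsto (fun n => (ℓ n : ℝ) * Real.exp (-c * ManyAccess.avgActive ℓ α n))
            atTop (𝓝 0)) →
        (Tendsto (ManyAccess.theta P ℓ α) atTop (𝓝 0) ∨
          ∃ c : ℝ, 0 < c ∧ ∀ᶠ n in atTop, c ≤ ManyAccess.theta P ℓ α n) →
        Antitone d → (∀ n, 0 < d n) →
        Tendsto (fun n => d n ^ 2 * ManyAccess.avgActive ℓ α n) atTop atTop →
        Tendsto (fun n => d n * Real.log (ManyAccess.avgActive ℓ α n)) atTop (𝓝 0) →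
        ∀ (N : ℕ → ℕ) (D : (n : ℕ) → ManyAccess.Decoder (N n) (ℓ n)),
          (∀ n, |(N n : ℝ) - ManyAccess.signatureLength P ε ℓ α n| < 1) →
          (∀ n S y, ManyAccess.IsLeastSquares ((1 + 2 * d n) * ManyAccess.avgActive ℓ α n)
            S y (D n S y)) →
          Tendsto (fun n => ManyAccess.errorProb (P - δ) (α n) (D n)) atTop (𝓝 0) := by
  have hexp : Real.exp (-(ε / 16)) < 1 := Real.exp_lt_one_iff.2 (by linarith)
  -- Chosen so that `log (P / (P - δ)) ≤ ε/16`, half of the margin constant `ε/8`.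
  refine ⟨P * (1 - Real.exp (-(ε / 16))), mul_pos hP (by linarith),
    by nlinarith [Real.exp_pos (-(ε / 16))], ?_⟩
  intro δ hδ0 hδ ℓ α d hk hkO _ hθ _ hd0 hdk hdl N D hN hD
  have hv : P * Real.exp (-(ε / 16)) < P - δ := by linarith
  have hv0 : 0 < P - δ := lt_trans (by positivity) hv
  have hlog : Real.log (P / (P - δ)) ≤ ε / 8 / 2 := by
    rw [Real.log_le_iff_le_exp (by positivity), div_le_iff₀ hv0]
    have h1 : Real.exp (ε / 8 / 2) * Real.exp (-(ε / 16)) = 1 := by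
      rw [← Real.exp_add]
      ring_nf
      exact Real.exp_zero
    nlinarith [mul_le_mul_of_nonneg_left hv.le (Real.exp_pos (ε / 8 / 2)).le]
  have hmargin : (∃ C, 0 < C ∧ ∀ᶠ n in atTop, ManyAccess.avgActive ℓ α n ≤ C * N n) ∧
      ∀ᶠ n in atTop, (ℓ n : ℝ) * Real.binEntropy (α n) + ε / 8 * N n ≤
        N n / 2 * Real.log (1 + ManyAccess.avgActive ℓ α n * P) := by
    unfold ManyAccess.signatureLength at hN
    by_cases h0 : Tendsto (ManyAccess.theta P ℓ α) atTop (𝓝 0)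
    · simp only [h0, if_true] at hN
      exact ManyAccess.margin_of_tendsto_theta hP hε hk hkO h0 hN _
    · simp only [h0, if_false] at hN
      obtain ⟨c, hc, hθc⟩ := hθ.resolve_left h0
      exact ManyAccess.margin_of_le_theta hP hε hk hkO hc hθc hN
  obtain ⟨⟨C, hC, hkN⟩, hcap⟩ := hmargin
  exact ManyAccess.tendsto_errorProb_zero hP hv0 (by linarith) (by positivity) hC hlog hk hkN hcap
    hd0 hdk hdl hD
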